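/- Let $f\colon X\to S^1$ be a continuous map on a topological space, let $\theta\in S^1$ be a tame value of $f$, i.e. the fiber $X_\theta=f^{-1}(\theta)$ is a neighborhood deformation retract in $X$ (some neighborhood $U$ of $X_\theta$ can be deformed in $X$ into $X_\theta$, keeping $X_\theta$ pointwise fixed), and let $\tilde\theta\in\mathbb R$ with $e^{i\tilde\theta}=\theta$. Let $\tilde X=\{(x,t)\in X\times\mathbb R: f(x)=e^{it}\}$, $\tilde f(x,t)=t$, $\tau(x,t)=(x,t+2\pi)$, and identify $X_\theta$ with $\tilde f^{-1}(\tilde\theta)$. For $I\subseteq\mathbb R$ write $\tilde X_I=\tilde f^{-1}(I)$. Let $H_*$ be singular homology with coefficients in a fixed module over a commutative ring, let $C_*$ be the corresponding singular chain complex, and let $H^{Nov,+}_*(\tilde X)$ and $H^{Nov,-}_*(\tilde X)$ be the homology of the complexes $\varprojlim_{r}C_*(\tilde X,\tilde X_{[r,\infty)})$ and $\varprojlim_{r}C_*(\tilde X,\tilde X_{(-\infty,r]})$, respectively (limits as $r\to+\infty$ and $r\to-\infty$). Let $R$ be the linear relation on $V=H_*(X_\theta)$ for which $aRb$ iff $a$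 and $\tau_*b$ coincide in $H_*(\tilde X_{[\tilde\theta,\tilde\theta+2\pi]})$. Put $$\begin{aligned} K_+&=\{v:\exists k,v_i:\ vRv_1R\cdots Rv_kR0\},& K_-&=\{v:\exists k,v_i:\ 0Rv_{-k}R\cdots Rv_{-1}Rv\},\\ D_+&=\{v:\exists v_i:\ vRv_1Rv_2R\cdots\},& D_-&=\{v:\exists v_i:\ \cdots Rv_{-2}Rv_{-1}Rv\}, \end{aligned}$$ $D=D_-\cap D_+$, $V_{reg}=D/((K_-+K_+)\cap D)$, and let $R_{reg}$ be the relation on $V_{reg}$ that relates two classes iff they have representatives in $D$ related by $R$. Then, in every degree, the inclusion $\iota\colon X_\theta\to\tilde X$ induces an isomorphism $$H_*(X_\theta)_{reg}\xrightarrow{\ \cong\ }\ker\bigl(H_*(\tilde X)\to H^{Nov,-}_*(\tilde X)\oplus H^{Nov,+}_*(\tilde X)\bigr),\qquad [d]\mapsto\iota_*d .$$ The map $\tau_*$ restricts to an automorphism of this kernel, and the isomorphism intertwines $R_{reg}$ with the inverse of $\tau_*$; that is, for $v,w\in H_*(X_\theta)_{reg}$ with images $\bar v,\bar w$ one has $v\,R_{reg}\,w$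 if and only if $\bar v=\tau_*\bar w$. Moreover, if the ring is a field, then in every degree in which $H_*(X_\theta)$ is finite dimensional the kernel above coincides with $\ker(H_*(\tilde X)\to H^{Nov,-}_*(\tilde X))$ and with $\ker(H_*(\tilde X)\to H^{Nov,+}_*(\tilde X))$, and these kernels are finite dimensional. -/

import Mathlib

open CategoryTheory CategoryTheory.Limits

universe u v

noncomputable section

/-! ### Linear relations on a module -/

namespace LinRel

variable {R : Type*} [CommRing R] {V : Type*} [AddCommGroup V] [Module R V]

/-- The transposed relation: `w ρ† v` iff `v ρ w`. -/
def dag (ρ : Submodule R (V × V)) : Submodule R (V × V) :=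
  ρ.comap (LinearEquiv.prodComm R V V).toLinearMap

/-- `K₊`: those `v` for which there are `k` and `v ρ v₁ ρ v₂ ρ ⋯ ρ v_k ρ 0`. -/
def Kplus (ρ : Submodule R (V × V)) : Submodule R V where
  carrier := {v | ∃ (k : ℕ) (s : ℕ → V), s 0 = v ∧ s (k + 1) = 0 ∧ ∀ i ≤ k, (s i, s (i + 1)) ∈ ρ}
  zero_mem' := ⟨0, fun _ => 0, rfl, rfl, fun _ _ => ρ.zero_mem⟩
  add_mem' := by
    have pad : ∀ (v : V) (k m : ℕ) (s : ℕ → V), s 0 = v → s (k + 1) = 0 →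
        (∀ i ≤ k, (s i, s (i + 1)) ∈ ρ) → k ≤ m →
        ∃ s' : ℕ → V, s' 0 = v ∧ s' (m + 1) = 0 ∧ ∀ i ≤ m, (s' i, s' (i + 1)) ∈ ρ := by
      intro v k m s h0 hk hs hkm
      refine ⟨fun i => if i ≤ k then s i else 0, by simpa using h0, ?_, ?_⟩
      · have : ¬ m + 1 ≤ k := by omega
        simp [this]
      · intro i _
        rcases lt_trichotomy i k with h | h | h
        · have h1 : i ≤ k := by omega
          have h2 : i + 1 ≤ k := by omega
          simpa [h1, h2] using hs i h1
        · subst h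
          simpa [hk] using hs i le_rfl
        · have h1 : ¬ i ≤ k := by omega
          have h2 : ¬ i + 1 ≤ k := by omega
          simp only [h1, h2, if_false]
          exact ρ.zero_mem
    rintro v w ⟨k, s, s0, sk, hs⟩ ⟨l, t, t0, tl, ht⟩
    obtain ⟨s', s0', sk', hs'⟩ := pad v k (max k l) s s0 sk hs (le_max_left _ _)
    obtain ⟨t', t0', tl', ht'⟩ := pad w l (max k l) t t0 tl ht (le_max_right _ _)
    exact ⟨max k l, fun i => s' i + t' i, by simp [s0', t0'], by simp [sk', tl'],
      fun i hi => ρ.add_mem (hs' i hi) (ht' i hi)⟩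
  smul_mem' := by
    rintro c v ⟨k, s, s0, sk, hs⟩
    exact ⟨k, fun i => c • s i, by simp [s0], by simp [sk], fun i hi => ρ.smul_mem c (hs i hi)⟩

/-- `D₊`: those `v` for which there is an infinite sequence `v ρ v₁ ρ v₂ ρ ⋯`. -/
def Dplus (ρ : Submodule R (V × V)) : Submodule R V where
  carrier := {v | ∃ s : ℕ → V, s 0 = v ∧ ∀ i, (s i, s (i + 1)) ∈ ρ}
  zero_mem' := ⟨fun _ => 0, rfl, fun _ => ρ.zero_mem⟩
  add_mem' := by
    rintro v w ⟨s, s0, hs⟩ ⟨t, t0, ht⟩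
    exact ⟨fun i => s i + t i, by simp [s0, t0], fun i => ρ.add_mem (hs i) (ht i)⟩
  smul_mem' := by
    rintro c v ⟨s, s0, hs⟩
    exact ⟨fun i => c • s i, by simp [s0], fun i => ρ.smul_mem c (hs i)⟩

/-- `K₋`: those `v` for which there are `k` and `0 ρ v₋ₖ ρ ⋯ ρ v₋₁ ρ v`. -/
def Kminus (ρ : Submodule R (V × V)) : Submodule R V := Kplus (dag ρ)

/-- `D₋`: those `v` for which there is an infinite sequence `⋯ ρ v₋₂ ρ v₋₁ ρ v`. -/
def Dminus (ρ : Submodule R (V × V)) : Submodule R V := Dplus (dag ρ)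

/-- `D = D₋ ∩ D₊`. -/
def Dtot (ρ : Submodule R (V × V)) : Submodule R V := Dminus ρ ⊓ Dplus ρ

/-- The regular part `V_reg = D / ((K₋ + K₊) ∩ D)`. -/
abbrev Reg (ρ : Submodule R (V × V)) : Type _ :=
  Dtot ρ ⧸ (Kminus ρ ⊔ Kplus ρ).submoduleOf (Dtot ρ)

/-- The projection `D → V_reg`. -/
def Reg.proj (ρ : Submodule R (V × V)) : Dtot ρ →ₗ[R] Reg ρ :=
  ((Kminus ρ ⊔ Kplus ρ).submoduleOf (Dtot ρ)).mkQ

/-- The relation `ρ_reg` on `V_reg`: two classes are related iff they have representatives in `D`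
which are related by `ρ`. -/
def regRel (ρ : Submodule R (V × V)) : Submodule R (Reg ρ × Reg ρ) :=
  (ρ.comap ((Dtot ρ).subtype.prodMap (Dtot ρ).subtype)).map ((Reg.proj ρ).prodMap (Reg.proj ρ))

end LinRel

/-! ### Singular chains, relative singular chains and Novikov complexes -/

namespace NovikovHomology

variable (R : Type v) [CommRing R] (M : Type u) [AddCommGroup M] [Module R M]

/-- The singular chain complex with coefficients in the `R`-module `M`. -/
abbrev chains : TopCat.{u} ⥤ ChainComplex (ModuleCat.{u} R) ℕ :=
  (AlgebraicTopology.singularChainComplexFunctor (ModuleCat.{u} R)).obj (ModuleCat.of R M)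

/-- Singular homology with coefficients in the `R`-module `M`. -/
abbrev H (n : ℕ) (X : Type u) [TopologicalSpace X] : ModuleCat.{u} R :=
  ((AlgebraicTopology.singularHomologyFunctor (ModuleCat.{u} R) n).obj (ModuleCat.of R M)).obj
    (TopCat.of X)

/-- The map induced on singular homology by a continuous map. -/
def Hmap (n : ℕ) {X Y : Type u} [TopologicalSpace X] [TopologicalSpace Y] (g : C(X, Y)) :
    H R M n X →ₗ[R] H R M n Y :=
  (((AlgebraicTopology.singularHomologyFunctor (ModuleCat.{u} R) n).obj (ModuleCat.of R M)).map
    (TopCat.ofHom g)).hom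

variable (Y : Type u) [TopologicalSpace Y]

/-- The subsets of `Y`, ordered by inclusion, as a diagram of spaces. -/
def subspaces : Set Y ⥤ TopCat.{u} where
  obj A := TopCat.of A
  map {_ _} i := TopCat.ofHom ⟨Set.inclusion (leOfHom i), continuous_inclusion (leOfHom i)⟩

/-- The inclusions of the subspaces of `Y` into `Y`. -/
def subspaceIncl : subspaces Y ⟶ (Functor.const (Set Y)).obj (TopCat.of Y) where
  app A := TopCat.ofHom (⟨Subtype.val, continuous_subtype_val⟩ : C(A, Y))

/-- The inclusions `C_*(A) → C_*(Y)`, natural in the subset `A` of `Y`. -/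
def chainsIncl :
    subspaces Y ⋙ chains R M ⟶ (Functor.const (Set Y)).obj ((chains R M).obj (TopCat.of Y)) where
  app A := (chains R M).map ((subspaceIncl Y).app A)
  naturality A B i := by
    have h := (subspaceIncl Y).naturality i
    have h' := congrArg (chains R M).map h
    simp only [Functor.map_comp] at h'
    simpa using h'

/-- The relative singular chain complexes `C_*(Y, A) = C_*(Y) / C_*(A)`, as a diagram indexed by the
subsets `A` of `Y`. -/
def relChains : Set Y ⥤ ChainComplex (ModuleCat.{u} R) ℕ where
  obj A := cokernel ((chainsIncl R M Y).app A)
  map {A B} i := cokernel.map _ _ ((subspaces Y ⋙ chains R M).map i) (𝟙 _)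
    (by simpa using ((chainsIncl R M Y).naturality i).symm)
  map_id A := (cancel_epi (cokernel.π _)).1 (by simp)
  map_comp i j := (cancel_epi (cokernel.π _)).1 (by simp)

/-- The projections `C_*(Y) → C_*(Y, A)`. -/
def toRelChains :
    (Functor.const (Set Y)).obj ((chains R M).obj (TopCat.of Y)) ⟶ relChains R M Y where
  app A := cokernel.π ((chainsIncl R M Y).app A)
  naturality A B i := by simp [relChains]

variable {Y} (g : Y → ℝ)

/-- The superlevel sets `{g ≥ r}`, which decrease as `r` grows. -/
def superlevel : ℝᵒᵖ ⥤ Set Y where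
  obj r := g ⁻¹' Set.Ici r.unop
  map {_ _} i := homOfLE fun _ hy => le_trans (leOfHom i.unop) hy

/-- The sublevel sets `{g ≤ r}`, which decrease as `r` tends to `-∞`. -/
def sublevel : ℝ ⥤ Set Y where
  obj r := g ⁻¹' Set.Iic r
  map {_ _} i := homOfLE fun _ hy => le_trans hy (leOfHom i)

/-- The projection from `C_*(Y)` to the projective limit of the complexes `C_*(Y, A j)`. -/
def toLimit {J : Type} [Category.{0} J] (A : J ⥤ Set Y) :
    (chains R M).obj (TopCat.of Y) ⟶ limit (A ⋙ relChains R M Y) :=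
  limit.lift (A ⋙ relChains R M Y)
    { pt := (chains R M).obj (TopCat.of Y)
      π :=
        { app := fun j => (toRelChains R M Y).app (A.obj j)
          naturality := fun _ _ i => (toRelChains R M Y).naturality (A.map i) } }

/-- The upwards Novikov complex: the projective limit of `C_*(Y, {g ≥ r})` as `r → ∞`. -/
abbrev novPlus : ChainComplex (ModuleCat.{u} R) ℕ := limit (superlevel g ⋙ relChains R M Y)

/-- The downwards Novikov complex: the projective limit of `C_*(Y, {g ≤ r})` as `r → -∞`. -/
abbrev novMinus : ChainComplex (ModuleCat.{u} R) ℕ := limit (sublevel g ⋙ relChains R M Y)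

/-- The canonical map from singular homology to upwards Novikov homology. -/
def toNovPlus (n : ℕ) : H R M n Y →ₗ[R] (novPlus R M g).homology n :=
  (HomologicalComplex.homologyMap (toLimit R M (superlevel g)) n).hom

/-- The canonical map from singular homology to downwards Novikov homology. -/
def toNovMinus (n : ℕ) : H R M n Y →ₗ[R] (novMinus R M g).homology n :=
  (HomologicalComplex.homologyMap (toLimit R M (sublevel g)) n).hom

end NovikovHomology

/-! ### Angle valued maps -/

namespace AngleValued

open NovikovHomology

/-- `A` is a neighborhood deformation retract in `X`: a neighborhood `U` of `A` can be deformed in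
`X` into `A`, keeping the points of `A` fixed. (This holds if `A` is a deformation retract of a
neighborhood, and if `(X, A)` is an NDR pair.) -/
def IsNeighborhoodDeformationRetract {X : Type*} [TopologicalSpace X] (A : Set X) : Prop :=
  ∃ (U : Set X) (h : C(U × unitInterval, X)), U ∈ nhdsSet A ∧
    (∀ x : U, h (x, 0) = x) ∧ (∀ x : U, h (x, 1) ∈ A) ∧
    ∀ (x : U) (t : unitInterval), (x : X) ∈ A → h (x, t) = x

variable {X : Type u} [TopologicalSpace X] (f : C(X, Circle))

/-- The fiber `X_θ`. -/
abbrev Fiber (θ : Circle) : Type u := f ⁻¹' {θ}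

/-- `θ` is a tame value of `f`: the fiber over `θ` is a neighborhood deformation retract. -/
def IsTameValue (θ : Circle) : Prop := IsNeighborhoodDeformationRetract (f ⁻¹' {θ})

/-- The infinite cyclic covering of `f`, i.e. the pullback of `ℝ → S¹` along `f`. -/
abbrev Cover : Type u := {p : X × ℝ // f p.1 = Circle.exp p.2}

/-- The lift `f̃ : X̃ → ℝ` of `f`. -/
def lift (p : Cover f) : ℝ := p.1.2

/-- The fundamental deck transformation `τ`, with `f̃ ∘ τ = f̃ + 2π`. -/
def deck : C(Cover f, Cover f) where
  toFun p := ⟨(p.1.1, p.1.2 + 2 * Real.pi), by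
    rw [Circle.exp_add, Circle.exp_two_pi, mul_one]; exact p.2⟩
  continuous_toFun := by fun_prop

/-- The slab `f̃⁻¹([a, b])` of `X̃`. -/
abbrev Slab (a b : ℝ) : Type u := {p : Cover f // lift f p ∈ Set.Icc a b}

variable {f} {t : ℝ}

/-- The inclusion of `X_θ = X̃_t` into `X̃`, where `t` is a lift of the angle `θ`. -/
def inclCover {θ : Circle} (ht : Circle.exp t = θ) : C(Fiber f θ, Cover f) where
  toFun x := ⟨(x.1, t), (x.2 : f x.1 = θ).trans ht.symm⟩
  continuous_toFun := by fun_prop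

/-- The inclusion of `X_θ = X̃_t` as the lower end of the slab `f̃⁻¹([t, t + 2π])`. -/
def inclLower {θ : Circle} (ht : Circle.exp t = θ) :
    C(Fiber f θ, Slab f t (t + 2 * Real.pi)) where
  toFun x := ⟨inclCover ht x, le_rfl, by
    have := Real.pi_pos
    change t ≤ t + 2 * Real.pi
    linarith⟩
  continuous_toFun := by fun_prop

/-- The map `X_θ = X̃_t → X̃_{t + 2π}` given by `τ`, into the upper end of the slab
`f̃⁻¹([t, t + 2π])`. -/
def inclUpper {θ : Circle} (ht : Circle.exp t = θ) :
    C(Fiber f θ, Slab f t (t + 2 * Real.pi)) where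
  toFun x := ⟨deck f (inclCover ht x), by
    have := Real.pi_pos
    change t ≤ t + 2 * Real.pi
    linarith, le_rfl⟩
  continuous_toFun := by fun_prop

variable (R : Type v) [CommRing R] (M : Type u) [AddCommGroup M] [Module R M]

/-- The linear relation on `H_n(X_θ)`: `a` is related to `b` iff `a` and `τ_* b` coincide in
`H_n(f̃⁻¹([t, t + 2π]))`. -/
def monodromyRel (n : ℕ) {θ : Circle} (ht : Circle.exp t = θ) :
    Submodule R (H R M n (Fiber f θ) × H R M n (Fiber f θ)) :=
  LinearMap.eqLocus
    (Hmap R M n (inclLower (f := f) ht) ∘ₗ LinearMap.fst R _ _)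
    (Hmap R M n (inclUpper (f := f) ht) ∘ₗ LinearMap.snd R _ _)

variable (f)

/-- The kernel of `H_n(X̃) → H_n^{Nov,-}(X̃) ⊕ H_n^{Nov,+}(X̃)`. -/
def commonKer (n : ℕ) : Submodule R (H R M n (Cover f)) :=
  LinearMap.ker ((toNovMinus R M (lift f) n).prod (toNovPlus R M (lift f) n))

end AngleValued

end

/-!
Write `F` for the fiber, `ρ` for the relation on its homology, and cut the covering along the lifts
`F_k` of the fiber at the heights `t + 2πk`, with `k` an integer. The proof uses three facts about
this cutting, and is formal from there on.

* Mayer–Vietoris: if classes of two pieces that meet in `F_k` agree in the union of the pieces, then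
  they come from a common class of `F_k` (`AngleValued.exists_of_fiber`). Only this consequence of
  exactness is needed. For open covers it follows from barycentric subdivision
  (`SingChains.exists_of_interior_cover`). For closed pieces, subdivision gives a class of a
  neighborhood of `F_k`, and the deformation of that neighborhood, lifted from the base, moves it
  into `F_k` (`SingChains.exists_of_isClosed_cover`). The end of the deformation extends by the
  identity to a retraction onto the piece, which is why a deformation inside the whole space suffices.
* Compact supports: a class and its vanishing are visible in a finite union of slabs.
* A class of the covering is killed in the upwards Novikov homology if and only if it comes from a
  sequence of classes of the superlevel sets at the heights `t + 2πk`, `k ≥ 0`, each of which is the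
  image of the next (`SingChains.exists_seq_of_toLimit_eq_zero`,
  `SingChains.toLimit_eq_zero_of_seq`). A bounding chain in the limit complex is the same as a
  compatible family of relative chains, and its successive truncations give these classes.

By the first fact, cutting along the `F_k` one after the other, a class of `F_0` vanishes in the
part of the covering above `F_0` if and only if it lies in `K₊`, and is part of a compatible
sequence as above if and only if it lies in `D₊`. Turning everything upside down
(`NovikovHomology.SlabSystem.dual`) gives the same for `K₋` and `D₋`. Cutting the whole covering
along `F_0` then shows that the kernel of the homology of `F` in that of the covering is `K₋ + K₊`
(`NovikovHomology.SlabSystem.ι_eq_zero_iff`) and that the common kernel of the two maps to Novikov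
homology is the image of `D` (`NovikovHomology.SlabSystem.isUpLimit_and_iff`). This is the
isomorphism. If `v ρ w`, then the images of `v` and `τ_* w` agree; since every element of `D` has a
successor and a predecessor in `D`, this determines `τ_*` on the common kernel.

If the homology of `F` is Artinian, then a descending chain argument gives `D₊ ⊆ D + K₊`
(`LinRel.Dplus_le_of_isArtinian`). Every class in the kernel of one of the two maps comes from `D₊`
of some `F_k`, hence from `D`, and so lies in the common kernel
(`NovikovHomology.SlabSystem.exists_mem_Dtot_of_isUpLimit`).
-/

noncomputable section

/-! ### Chains on a semisimplicial set -/

namespace AltChains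

variable (R : Type*) [CommRing R] (M : Type*) [AddCommGroup M] [Module R M]
  {S S' : ℕ → Type*} (δ : ∀ n, Fin (n + 2) → S (n + 1) → S n)
  (δ' : ∀ n, Fin (n + 2) → S' (n + 1) → S' n)

/-- The alternating sum of the face maps, on chains with coefficients in `M`. -/
def bd (n : ℕ) : (S (n + 1) →₀ M) →ₗ[R] (S n →₀ M) :=
  ∑ i : Fin (n + 2), (-1 : ℤ) ^ (i : ℕ) • Finsupp.lmapDomain M R (δ n i)

lemma bd_apply (n : ℕ) (c : S (n + 1) →₀ M) :
    bd R M δ n c = ∑ i : Fin (n + 2), (-1 : ℤ) ^ (i : ℕ) • Finsupp.mapDomain (δ n i) c := by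
  simp [bd, LinearMap.sum_apply]

lemma bd_single (n : ℕ) (x : S (n + 1)) (m : M) :
    bd R M δ n (Finsupp.single x m) =
      ∑ i : Fin (n + 2), (-1 : ℤ) ^ (i : ℕ) • Finsupp.single (δ n i x) m := by
  simp [bd_apply]

variable {δ δ'} in
lemma bd_mapDomain (g : ∀ n, S n → S' n)
    (hg : ∀ n i x, g n (δ n i x) = δ' n i (g (n + 1) x)) (n : ℕ) (c : S (n + 1) →₀ M) :
    bd R M δ' n (Finsupp.mapDomain (g (n + 1)) c) = Finsupp.mapDomain (g n) (bd R M δ n c) := by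
  simp only [bd_apply]
  rw [← Finsupp.lmapDomain_apply M R (g n), map_sum]
  refine Finset.sum_congr rfl fun i _ => ?_
  rw [map_zsmul, Finsupp.lmapDomain_apply, ← Finsupp.mapDomain_comp, ← Finsupp.mapDomain_comp]
  congr 2
  funext x
  exact (hg n i x).symm

variable {δ} in
lemma bd_bd (hδ : ∀ n (i j : Fin (n + 2)) (x : S (n + 2)), i ≤ j →
      δ n i (δ (n + 1) j.succ x) = δ n j (δ (n + 1) i.castSucc x))
    (n : ℕ) (c : S (n + 2) →₀ M) : bd R M δ n (bd R M δ (n + 1) c) = 0 := by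
  induction c using Finsupp.induction_linear with
  | zero => simp
  | add c d hc hd => rw [map_add, map_add, hc, hd, add_zero]
  | single x m =>
    simp only [bd_single, map_sum, map_zsmul, Finset.smul_sum]
    rw [← Finset.sum_product', Finset.univ_product_univ]
    -- The terms indexed by `(j, i)` with `j ≤ i` cancel against those with `i < j`.
    rw [← Finset.sum_filter_add_sum_filter_not Finset.univ
      (fun p : Fin (n + 3) × Fin (n + 2) => (p.1 : ℕ) ≤ p.2), add_eq_zero_iff_eq_neg,
      ← Finset.sum_neg_distrib]
    refine Finset.sum_bij' (fun p hp => (p.2.succ, p.1.castLT (by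
        have := (Finset.mem_filter.1 hp).2; have := p.2.2; omega)))
      (fun p hp => (p.2.castSucc, p.1.pred (by
        have := (Finset.mem_filter.1 hp).2
        intro h
        simp [h] at this))) ?_ ?_ ?_ ?_ ?_
    · rintro ⟨j, i⟩ hp
      have := (Finset.mem_filter.1 hp).2
      simp at this ⊢
      omega
    · rintro ⟨j, i⟩ hp
      have := (Finset.mem_filter.1 hp).2
      simp at this ⊢
      omega
    · rintro ⟨j, i⟩ hp
      simp
    · rintro ⟨j, i⟩ hp
      simp
    · rintro ⟨j, i⟩ hp
      have h := (Finset.mem_filter.1 hp).2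
      simp only at h
      have hlt : (j : ℕ) < n + 2 := by have := i.2; omega
      have e := hδ n (j.castLT hlt) i x (by simpa [Fin.le_def] using h)
      rw [Fin.castSucc_castLT] at e
      simp only [smul_smul, Fin.val_succ, Fin.val_castLT]
      rw [← e, ← neg_smul]
      congr 1
      ring

end AltChains

/-! ### Barycentric subdivision of affine chains -/

namespace AffineChains

open AltChains

variable (R : Type*) [CommRing R] (M : Type*) [AddCommGroup M] [Module R M]

/-- The `i`-th face of a simplex given by its list of vertices. -/
def face (Δ : Type*) (n : ℕ) (i : Fin (n + 2)) (w : Fin (n + 2) → Δ) : Fin (n + 1) → Δ :=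
  w ∘ i.succAbove

/-- The boundary of affine chains, i.e. of chains on the simplices given by lists of vertices. -/
abbrev bdA (Δ : Type*) (n : ℕ) :
    ((Fin (n + 2) → Δ) →₀ M) →ₗ[R] ((Fin (n + 1) → Δ) →₀ M) :=
  bd R M (S := fun n => Fin (n + 1) → Δ) (face Δ) n

variable {Δ Δ' : Type*}

lemma bdA_bdA (n : ℕ) (c : (Fin (n + 3) → Δ) →₀ M) : bdA R M Δ n (bdA R M Δ (n + 1) c) = 0 := by
  refine bd_bd R M (S := fun n => Fin (n + 1) → Δ) ?_ n c
  intro n i j x hij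
  funext k
  have := congrArg (fun g => g.toOrderHom k) (SimplexCategory.δ_comp_δ hij)
  simp only [face, Function.comp_apply]
  exact congrArg x this

/-- The cone with apex `b` over an affine chain. -/
def cone (b : Δ) (n : ℕ) : ((Fin (n + 1) → Δ) →₀ M) →ₗ[R] ((Fin (n + 2) → Δ) →₀ M) :=
  Finsupp.lmapDomain M R (fun w => Fin.cons b w)

lemma cone_single (b : Δ) (n : ℕ) (w : Fin (n + 1) → Δ) (m : M) :
    cone R M b n (Finsupp.single w m) = Finsupp.single (Fin.cons b w : Fin (n + 2) → Δ) m := by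
  simp [cone]

lemma face_zero_cons (b : Δ) (n : ℕ) (w : Fin (n + 1) → Δ) :
    face Δ n 0 (Fin.cons b w : Fin (n + 2) → Δ) = w := by
  funext k
  simp [face]

lemma face_succ_cons (b : Δ) (n : ℕ) (i : Fin (n + 2)) (w : Fin (n + 2) → Δ) :
    face Δ (n + 1) i.succ (Fin.cons b w : Fin (n + 3) → Δ) =
      (Fin.cons b (face Δ n i w) : Fin (n + 2) → Δ) := by
  funext k
  refine Fin.cases ?_ (fun k => ?_) k <;> simp [face]

lemma bdA_cone (b : Δ) (n : ℕ) (c : (Fin (n + 2) → Δ) →₀ M) :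
    bdA R M Δ (n + 1) (cone R M b (n + 1) c) = c - cone R M b n (bdA R M Δ n c) := by
  induction c using Finsupp.induction_linear with
  | zero => simp
  | add c d hc hd => simp only [map_add, hc, hd]; abel
  | single w m =>
    rw [cone_single, bd_single, Fin.sum_univ_succ, face_zero_cons, bd_single, map_sum,
      sub_eq_add_neg, ← Finset.sum_neg_distrib]
    simp [face_succ_cons, cone_single, pow_succ]

lemma bdA_cone_zero_single (b : Δ) (v : Fin 1 → Δ) (m : M) :
    bdA R M Δ 0 (cone R M b 0 (Finsupp.single v m)) =
      Finsupp.single v m - Finsupp.single (fun _ => b) m := by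
  have h : face Δ 0 1 (Fin.cons b v : Fin 2 → Δ) = fun _ => b := by
    funext k
    obtain rfl : k = 0 := Fin.fin_one_eq_zero k
    simp [face]
  rw [cone_single, bd_single, Fin.sum_univ_two, face_zero_cons, h]
  simp [sub_eq_add_neg]

/-- In degree `0`, the boundary of a cone is the given chain up to multiples of the apex; these
cancel on boundaries. -/
lemma bdA_cone_bdA (b : Δ) (c : (Fin 2 → Δ) →₀ M) :
    bdA R M Δ 0 (cone R M b 0 (bdA R M Δ 0 c)) = bdA R M Δ 0 c := by
  induction c using Finsupp.induction_linear with
  | zero => simp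
  | add c d hc hd => simp only [map_add, hc, hd]
  | single w m =>
    have e : bdA R M Δ 0 (Finsupp.single w m) =
        Finsupp.single (face Δ 0 0 w) m - Finsupp.single (face Δ 0 1 w) m := by
      rw [bd_single, Fin.sum_univ_two]
      simp [sub_eq_add_neg]
    rw [e, map_sub, map_sub, bdA_cone_zero_single, bdA_cone_zero_single, sub_sub_sub_cancel_right]

variable (bary : ∀ n, (Fin (n + 1) → Δ) → Δ) (bary' : ∀ n, (Fin (n + 1) → Δ') → Δ')

/-- Barycentric subdivision of affine chains, for a choice `bary` of barycenters: the cone from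
the barycenter over the subdivision of the boundary. -/
def sd : ∀ n, ((Fin (n + 1) → Δ) →₀ M) →ₗ[R] ((Fin (n + 1) → Δ) →₀ M)
  | 0 => LinearMap.id
  | n + 1 => Finsupp.lsum ℕ fun w =>
      cone R M (bary (n + 1) w) n ∘ₗ sd n ∘ₗ bdA R M Δ n ∘ₗ Finsupp.lsingle w

/-- The chain homotopy between barycentric subdivision and the identity. -/
def sdHtpy : ∀ n, ((Fin (n + 1) → Δ) →₀ M) →ₗ[R] ((Fin (n + 2) → Δ) →₀ M)
  | 0 => 0
  | n + 1 => Finsupp.lsum ℕ fun w =>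
      cone R M (bary (n + 1) w) (n + 1) ∘ₗ (LinearMap.id - sdHtpy n ∘ₗ bdA R M Δ n) ∘ₗ
        Finsupp.lsingle w

lemma sd_zero (c : (Fin 1 → Δ) →₀ M) : sd R M bary 0 c = c := rfl

lemma sd_succ_single (n : ℕ) (w : Fin (n + 2) → Δ) (m : M) :
    sd R M bary (n + 1) (Finsupp.single w m) =
      cone R M (bary (n + 1) w) n (sd R M bary n (bdA R M Δ n (Finsupp.single w m))) := by
  simp [sd]

lemma sdHtpy_zero (c : (Fin 1 → Δ) →₀ M) : sdHtpy R M bary 0 c = 0 := rfl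

lemma sdHtpy_succ_single (n : ℕ) (w : Fin (n + 2) → Δ) (m : M) :
    sdHtpy R M bary (n + 1) (Finsupp.single w m) =
      cone R M (bary (n + 1) w) (n + 1) (Finsupp.single w m -
        sdHtpy R M bary n (bdA R M Δ n (Finsupp.single w m))) := by
  simp [sdHtpy]

lemma bdA_sd (n : ℕ) (c : (Fin (n + 2) → Δ) →₀ M) :
    bdA R M Δ n (sd R M bary (n + 1) c) = sd R M bary n (bdA R M Δ n c) := by
  induction n with
  | zero =>
    induction c using Finsupp.induction_linear with
    | zero => simp
    | add c d hc hd => simp only [map_add, hc, hd]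
    | single w m => exact (congrArg _ (sd_succ_single R M bary 0 w m)).trans (bdA_cone_bdA R M _ _)
  | succ n ih =>
    induction c using Finsupp.induction_linear with
    | zero => simp
    | add c d hc hd => simp only [map_add, hc, hd]
    | single w m => rw [sd_succ_single, bdA_cone, ih, bdA_bdA, map_zero, map_zero, sub_zero]

lemma bdA_sdHtpy_zero (c : (Fin 1 → Δ) →₀ M) :
    bdA R M Δ 0 (sdHtpy R M bary 0 c) = c - sd R M bary 0 c := by
  simp [sdHtpy_zero, sd_zero]

lemma bdA_sdHtpy (n : ℕ) (c : (Fin (n + 2) → Δ) →₀ M) :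
    bdA R M Δ (n + 1) (sdHtpy R M bary (n + 1) c) =
      c - sd R M bary (n + 1) c - sdHtpy R M bary n (bdA R M Δ n c) := by
  induction n with
  | zero =>
    induction c using Finsupp.induction_linear with
    | zero => simp
    | add c d hc hd => simp only [map_add, hc, hd]; abel
    | single w m =>
      rw [sdHtpy_succ_single, sdHtpy_zero, bdA_cone, sd_succ_single, sd_zero, sub_zero, sub_zero]
  | succ n ih =>
    induction c using Finsupp.induction_linear with
    | zero => simp
    | add c d hc hd => simp only [map_add, hc, hd]; abel
    | single w m =>
      rw [sdHtpy_succ_single, bdA_cone, sd_succ_single, map_sub, ih, bdA_bdA, map_zero, sub_zero,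
        sub_sub_cancel]
      abel

section naturality

variable {bary bary'} (g : Δ → Δ') (hg : ∀ n w, g (bary n w) = bary' n (g ∘ w))

lemma bdA_mapDomain (n : ℕ) (c : (Fin (n + 2) → Δ) →₀ M) :
    bdA R M Δ' n (Finsupp.mapDomain (g ∘ ·) c) = Finsupp.mapDomain (g ∘ ·) (bdA R M Δ n c) :=
  bd_mapDomain R M (S := fun n => Fin (n + 1) → Δ) (S' := fun n => Fin (n + 1) → Δ')
    (fun _ w => g ∘ w) (fun _ _ _ => rfl) n c

lemma cone_mapDomain (b : Δ) (n : ℕ) (c : (Fin (n + 1) → Δ) →₀ M) :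
    cone R M (g b) n (Finsupp.mapDomain (g ∘ ·) c) =
      Finsupp.mapDomain (g ∘ ·) (cone R M b n c) := by
  simp only [cone, Finsupp.lmapDomain_apply, ← Finsupp.mapDomain_comp]
  congr 1
  funext w k
  refine Fin.cases ?_ (fun k => ?_) k <;> simp

include hg

lemma sd_mapDomain (n : ℕ) (c : (Fin (n + 1) → Δ) →₀ M) :
    sd R M bary' n (Finsupp.mapDomain (g ∘ ·) c) =
      Finsupp.mapDomain (g ∘ ·) (sd R M bary n c) := by
  induction n with
  | zero => rfl
  | succ n ih =>
    induction c using Finsupp.induction_linear with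
    | zero => simp
    | add c d hc hd => simp only [map_add, hc, hd, Finsupp.mapDomain_add]
    | single w m =>
      rw [Finsupp.mapDomain_single, sd_succ_single, sd_succ_single, ← cone_mapDomain, ← ih,
        ← bdA_mapDomain, Finsupp.mapDomain_single, hg]

lemma sdHtpy_mapDomain (n : ℕ) (c : (Fin (n + 1) → Δ) →₀ M) :
    sdHtpy R M bary' n (Finsupp.mapDomain (g ∘ ·) c) =
      Finsupp.mapDomain (g ∘ ·) (sdHtpy R M bary n c) := by
  induction n with
  | zero => simp [sdHtpy_zero]
  | succ n ih =>
    induction c using Finsupp.induction_linear with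
    | zero => simp
    | add c d hc hd => simp only [map_add, hc, hd, Finsupp.mapDomain_add]
    | single w m =>
      rw [Finsupp.mapDomain_single, sdHtpy_succ_single, sdHtpy_succ_single, ← cone_mapDomain,
        ← hg, ← Finsupp.mapDomain_single, bdA_mapDomain, ih]
      simp only [← Finsupp.lmapDomain_apply M R, map_sub]

end naturality

end AffineChains

/-! ### Affine simplices and their diameters -/

namespace AffineChains

variable {ι κ : Type*} [Fintype ι] [Fintype κ]

/-- The affine map from the standard simplex with prescribed values `w` at the vertices. -/
def aff (w : κ → stdSimplex ℝ ι) : C(stdSimplex ℝ κ, stdSimplex ℝ ι) where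
  toFun p := ⟨∑ j, p j • (w j : ι → ℝ), (convex_stdSimplex ℝ ι).sum_mem
    (fun j _ => p.2.1 j) p.2.2 fun j _ => (w j).2⟩
  continuous_toFun := by
    refine Continuous.subtype_mk ?_ _
    refine continuous_finsetSum _ fun j _ => ?_
    exact ((continuous_apply j).comp continuous_subtype_val).smul continuous_const

lemma aff_apply (w : κ → stdSimplex ℝ ι) (p : stdSimplex ℝ κ) (i : ι) :
    aff w p i = ∑ j, p j * w j i := by
  change (∑ j, p j • (w j : ι → ℝ)) i = _
  simp only [Finset.sum_apply, Pi.smul_apply, smul_eq_mul]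

lemma aff_vertex [DecidableEq ι] : aff (fun i : ι => stdSimplex.vertex (S := ℝ) i) = .id _ := by
  ext p i
  change aff _ p i = p i
  simp [aff_apply, Pi.single_apply]

lemma aff_comp_aff {l : Type*} [Fintype l] (v : κ → stdSimplex ℝ ι) (w : l → stdSimplex ℝ κ) :
    (aff v).comp (aff w) = aff (aff v ∘ w) := by
  ext p i
  change aff v (aff w p) i = aff (aff v ∘ w) p i
  simp only [aff_apply, Function.comp_apply, Finset.sum_mul, Finset.mul_sum]
  rw [Finset.sum_comm]
  exact Finset.sum_congr rfl fun _ _ => Finset.sum_congr rfl fun _ _ => mul_assoc _ _ _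

lemma aff_map {l : Type*} [Fintype l] (w : κ → stdSimplex ℝ ι) (g : l → κ)
    (p : stdSimplex ℝ l) : aff w (stdSimplex.map g p) = aff (w ∘ g) p := by
  classical
  ext i
  simp only [aff_apply, stdSimplex.map_coe, FunOnFinite.linearMap_apply_apply, Finset.sum_mul,
    Function.comp_apply]
  rw [← Finset.sum_fiberwise Finset.univ g]
  refine Finset.sum_congr rfl fun j _ => Finset.sum_congr rfl fun k hk => ?_
  rw [(Finset.mem_filter.1 hk).2]

/-- The barycenter of an affine simplex. -/
def bary (n : ℕ) (w : Fin (n + 1) → stdSimplex ℝ ι) : stdSimplex ℝ ι := aff w stdSimplex.barycenter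

lemma aff_bary (v : κ → stdSimplex ℝ ι) (n : ℕ) (w : Fin (n + 1) → stdSimplex ℝ κ) :
    aff v (bary n w) = bary n (aff v ∘ w) := by
  rw [bary, bary, ← aff_comp_aff]
  rfl

lemma dist_aff_le (w : κ → stdSimplex ℝ ι) (p : stdSimplex ℝ κ) (c : ι → ℝ) (r : ℝ)
    (h : ∀ j, dist (w j : ι → ℝ) c ≤ r) : dist (aff w p : ι → ℝ) c ≤ r :=
  (convex_closedBall c r).sum_mem (fun j _ => p.2.1 j) p.2.2 fun j _ => h j

lemma dist_bary_le (n : ℕ) (w : Fin (n + 1) → stdSimplex ℝ ι) (d : ℝ)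
    (h : ∀ i j, dist (w i) (w j) ≤ d) (i : Fin (n + 1)) :
    dist (bary n w) (w i) ≤ n / (n + 1) * d := by
  have hn : (0 : ℝ) < n + 1 := by positivity
  have e : (bary n w : ι → ℝ) - (w i : ι → ℝ) =
      ∑ j, ((n : ℝ) + 1)⁻¹ • ((w j : ι → ℝ) - (w i : ι → ℝ)) := by
    have : (bary n w : ι → ℝ) = ∑ j, ((n : ℝ) + 1)⁻¹ • (w j : ι → ℝ) := by
      change ∑ j, (stdSimplex.barycenter : stdSimplex ℝ (Fin (n + 1))) j • (w j : ι → ℝ) = _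
      refine Finset.sum_congr rfl fun j _ => ?_
      congr 1
      exact (stdSimplex.barycenter_apply j).trans (by simp)
    rw [this]
    simp only [smul_sub, Finset.sum_sub_distrib, Finset.sum_const, Finset.card_univ,
      Fintype.card_fin]
    rw [← Nat.cast_smul_eq_nsmul ℝ, smul_smul]
    push_cast
    rw [mul_inv_cancel₀ hn.ne', one_smul]
  rw [Subtype.dist_eq, dist_eq_norm]
  change ‖(bary n w : ι → ℝ) - (w i : ι → ℝ)‖ ≤ _
  rw [e, ← Finset.add_sum_erase _ _ (Finset.mem_univ i), sub_self, smul_zero, zero_add]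
  refine (norm_sum_le _ _).trans ?_
  refine (Finset.sum_le_card_nsmul _ _ (((n : ℝ) + 1)⁻¹ * d) fun j _ => ?_).trans ?_
  · rw [norm_smul, Real.norm_of_nonneg (inv_nonneg.2 hn.le), ← dist_eq_norm]
    exact mul_le_mul_of_nonneg_left (h j i) (inv_nonneg.2 hn.le)
  · rw [Finset.card_erase_of_mem (Finset.mem_univ i), Finset.card_univ, Fintype.card_fin,
      Nat.add_sub_cancel, nsmul_eq_mul, div_eq_mul_inv, mul_assoc]

variable (R : Type*) [CommRing R] (M : Type*) [AddCommGroup M] [Module R M]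

/-- The simplices with vertices in every ball that contains the vertices of `v`, and of diameter
at most `n / (n + 1) * d`. -/
def shrunk (n : ℕ) (v : Fin (n + 1) → stdSimplex ℝ ι) (d : ℝ) :
    Set (Fin (n + 1) → stdSimplex ℝ ι) :=
  {w | (∀ (c : ι → ℝ) (r : ℝ), (∀ i, dist (v i : ι → ℝ) c ≤ r) →
      ∀ i, dist (w i : ι → ℝ) c ≤ r) ∧ ∀ i j, dist (w i) (w j) ≤ n / (n + 1) * d}

lemma cons_mem_shrunk (n : ℕ) (v : Fin (n + 2) → stdSimplex ℝ ι) (d : ℝ)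
    (hv : ∀ i j, dist (v i) (v j) ≤ d) (k : Fin (n + 2)) (w : Fin (n + 1) → stdSimplex ℝ ι)
    (hw : w ∈ shrunk n (face _ n k v) d) :
    (Fin.cons (bary (n + 1) v) w : Fin (n + 2) → stdSimplex ℝ ι) ∈ shrunk (n + 1) v d := by
  have hd : 0 ≤ d := dist_nonneg.trans (hv 0 0)
  have hb : ∀ i, dist (bary (n + 1) v) (w i) ≤ (n + 1 : ℕ) / ((n + 1 : ℕ) + 1) * d := by
    intro i
    rw [dist_comm]
    refine hw.1 (bary (n + 1) v) _ (fun j => ?_) i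
    rw [dist_comm]
    exact dist_bary_le (n + 1) v d hv _
  refine ⟨fun c r h i => ?_, fun i j => ?_⟩
  · refine Fin.cases ?_ (fun i => ?_) i
    · exact dist_aff_le v _ c r h
    · rw [Fin.cons_succ]
      exact hw.1 c r (fun j => h _) i
  · have hr : (0 : ℝ) ≤ (n + 1 : ℕ) / ((n + 1 : ℕ) + 1) * d := by positivity
    induction i using Fin.cases with
    | zero =>
      induction j using Fin.cases with
      | zero => rw [dist_self]; exact hr
      | succ j => rw [Fin.cons_zero, Fin.cons_succ]; exact hb j
    | succ i =>
      induction j using Fin.cases with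
      | zero => rw [Fin.cons_zero, Fin.cons_succ, dist_comm]; exact hb i
      | succ j =>
        rw [Fin.cons_succ, Fin.cons_succ]
        refine (hw.2 i j).trans (mul_le_mul_of_nonneg_right ?_ hd)
        rw [div_le_div_iff₀ (by positivity) (by positivity)]
        push_cast
        nlinarith

lemma sd_single_mem_supported (n : ℕ) (v : Fin (n + 1) → stdSimplex ℝ ι) (d : ℝ)
    (hv : ∀ i j, dist (v i) (v j) ≤ d) (m : M) :
    sd R M bary n (Finsupp.single v m) ∈ Finsupp.supported M R (shrunk n v d) := by
  induction n with
  | zero =>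
    rw [sd_zero]
    refine Finsupp.single_mem_supported R m ⟨fun c r h => h, fun i j => ?_⟩
    rw [Subsingleton.elim (α := Fin 1) i j]
    simp
  | succ n ih =>
    rw [sd_succ_single, AltChains.bd_single, map_sum, map_sum]
    refine Submodule.sum_mem _ fun k _ => ?_
    rw [map_zsmul, map_zsmul]
    refine zsmul_mem ?_ _
    have h := ih (face _ n k v) fun i j => hv _ _
    rw [cone, Finsupp.lmapDomain_apply]
    rw [Finsupp.mem_supported] at h ⊢
    classical
    intro w hw
    obtain ⟨w', hw', rfl⟩ := Finset.mem_image.1 (Finsupp.mapDomain_support hw)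
    exact cons_mem_shrunk n v d hv k w' (h hw')

/-- Barycentric subdivision multiplies the diameters of `n`-simplices by at most `n / (n + 1)`. -/
lemma sd_mem_supported (n : ℕ) (d : ℝ) (c : (Fin (n + 1) → stdSimplex ℝ ι) →₀ M)
    (hc : c ∈ Finsupp.supported M R {w | ∀ i j, dist (w i) (w j) ≤ d}) :
    sd R M bary n c ∈
      Finsupp.supported M R {w | ∀ i j, dist (w i) (w j) ≤ (n / (n + 1) : ℝ) * d} := by
  rw [← Finsupp.sum_single c, Finsupp.sum, map_sum]
  refine Submodule.sum_mem _ fun v hv => ?_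
  exact Finsupp.supported_mono (fun w hw => hw.2)
    (sd_single_mem_supported R M n v d (hc hv) (c v))

lemma iterate_sd_mem_supported (n : ℕ) (c : (Fin (n + 1) → stdSimplex ℝ ι) →₀ M) (N : ℕ) :
    (sd R M bary n)^[N] c ∈
      Finsupp.supported M R {w | ∀ i j, dist (w i) (w j) ≤ (n / (n + 1) : ℝ) ^ N} := by
  induction N with
  | zero =>
    refine (Finsupp.mem_supported R _).2 fun w _ i j => ?_
    rw [pow_zero, Subtype.dist_eq]
    exact (Metric.dist_le_diam_of_mem (bounded_stdSimplex ι) (w i).2 (w j).2).trans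
      diam_stdSimplex_le
  | succ N ih =>
    rw [Function.iterate_succ_apply', pow_succ']
    exact sd_mem_supported R M n _ _ ih

end AffineChains

/-! ### Subdivision of singular chains -/

namespace SingChains

open AltChains AffineChains

/-- The singular `n`-simplices of `X`. -/
abbrev Sing (n : ℕ) (X : Type*) [TopologicalSpace X] := C(stdSimplex ℝ (Fin (n + 1)), X)

variable (R : Type*) [CommRing R] (M : Type*) [AddCommGroup M] [Module R M]
variable {X Y Z : Type*} [TopologicalSpace X] [TopologicalSpace Y] [TopologicalSpace Z]

/-- The identity of the standard simplex, as the list of its vertices. -/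
abbrev verts (n : ℕ) : Fin (n + 1) → stdSimplex ℝ (Fin (n + 1)) :=
  fun i => stdSimplex.vertex (S := ℝ) i

variable (X) in
/-- The faces of a singular simplex. -/
def faceS (n : ℕ) (i : Fin (n + 2)) (σ : Sing (n + 1) X) : Sing n X :=
  σ.comp (aff (verts (n + 1) ∘ i.succAbove))

variable (X) in
/-- The boundary of singular chains, where singular chains are finitely supported functions on
the set of singular simplices. -/
abbrev bdS (n : ℕ) : (Sing (n + 1) X →₀ M) →ₗ[R] (Sing n X →₀ M) :=
  bd R M (S := fun n => Sing n X) (faceS X) n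

/-- The map on singular chains that is induced by a continuous map. -/
def push (g : C(X, Y)) (n : ℕ) : (Sing n X →₀ M) →ₗ[R] (Sing n Y →₀ M) :=
  Finsupp.lmapDomain M R (fun σ => g.comp σ)

lemma push_single (g : C(X, Y)) (n : ℕ) (σ : Sing n X) (m : M) :
    push R M g n (Finsupp.single σ m) = Finsupp.single (g.comp σ) m := by
  simp [push]

lemma push_comp (g : C(X, Y)) (h : C(Y, Z)) (n : ℕ) (c : Sing n X →₀ M) :
    push R M (h.comp g) n c = push R M h n (push R M g n c) := by
  simp only [push, Finsupp.lmapDomain_apply, ← Finsupp.mapDomain_comp]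
  rfl

lemma bdS_push (g : C(X, Y)) (n : ℕ) (c : Sing (n + 1) X →₀ M) :
    bdS R M Y n (push R M g (n + 1) c) = push R M g n (bdS R M X n c) :=
  bd_mapDomain R M (S := fun n => Sing n X) (S' := fun n => Sing n Y)
    (fun _ σ => g.comp σ) (fun _ _ _ => rfl) n c

lemma push_injective {g : C(X, Y)} (hg : Function.Injective g) (n : ℕ) :
    Function.Injective (push R M g n) :=
  Finsupp.mapDomain_injective fun σ τ h => by
    ext p
    exact hg (DFunLike.congr_fun h p)

/-- The singular chain that an affine chain on the standard simplex determines on `σ`. -/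
def realize {k : ℕ} (σ : Sing k X) (n : ℕ) :
    ((Fin (n + 1) → stdSimplex ℝ (Fin (k + 1))) →₀ M) →ₗ[R] (Sing n X →₀ M) :=
  Finsupp.lmapDomain M R (fun w => σ.comp (aff w))

lemma realize_single {k : ℕ} (σ : Sing k X) (n : ℕ)
    (w : Fin (n + 1) → stdSimplex ℝ (Fin (k + 1))) (m : M) :
    realize R M σ n (Finsupp.single w m) = Finsupp.single (σ.comp (aff w)) m := by
  simp [realize]

lemma realize_verts {n : ℕ} (σ : Sing n X) (m : M) :
    realize R M σ n (Finsupp.single (verts n) m) = Finsupp.single σ m := by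
  rw [realize_single, aff_vertex, ContinuousMap.comp_id]

lemma aff_comp_verts {k n : ℕ} (w : Fin (n + 1) → stdSimplex ℝ (Fin (k + 1))) :
    aff w ∘ verts n = w := by
  funext j
  ext i
  simp [aff_apply, Pi.single_apply]

lemma bdS_realize {k : ℕ} (σ : Sing k X) (n : ℕ)
    (c : (Fin (n + 2) → stdSimplex ℝ (Fin (k + 1))) →₀ M) :
    bdS R M X n (realize R M σ (n + 1) c) = realize R M σ n (bdA R M _ n c) := by
  have hface : ∀ (n : ℕ) (i : Fin (n + 2)) (w : Fin (n + 2) → stdSimplex ℝ (Fin (k + 1))),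
      σ.comp (aff (face _ n i w)) = faceS X n i (σ.comp (aff w)) := by
    intro n i w
    rw [faceS, ContinuousMap.comp_assoc, aff_comp_aff, ← Function.comp_assoc, aff_comp_verts]
    rfl
  have h := bd_mapDomain R M (S := fun n => Fin (n + 1) → stdSimplex ℝ (Fin (k + 1)))
    (S' := fun n => Sing n X) (δ := face (stdSimplex ℝ (Fin (k + 1)))) (δ' := faceS X)
    (fun _ w => σ.comp (aff w)) hface n c
  rw [realize, realize, Finsupp.lmapDomain_apply, Finsupp.lmapDomain_apply]
  exact h

lemma realize_mapDomain {k l : ℕ} (σ : Sing k X) (w : Fin (l + 1) → stdSimplex ℝ (Fin (k + 1)))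
    (n : ℕ) (c : (Fin (n + 1) → stdSimplex ℝ (Fin (l + 1))) →₀ M) :
    realize R M σ n (Finsupp.mapDomain (aff w ∘ ·) c) = realize R M (σ.comp (aff w)) n c := by
  simp only [realize, Finsupp.lmapDomain_apply, ← Finsupp.mapDomain_comp]
  congr 1
  funext v
  rw [Function.comp_apply, ← aff_comp_aff, ContinuousMap.comp_assoc]

lemma push_realize {k : ℕ} (g : C(X, Y)) (σ : Sing k X) (n : ℕ)
    (c : (Fin (n + 1) → stdSimplex ℝ (Fin (k + 1))) →₀ M) :
    push R M g n (realize R M σ n c) = realize R M (g.comp σ) n c := by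
  simp only [push, realize, Finsupp.lmapDomain_apply, ← Finsupp.mapDomain_comp]
  rfl

variable (X) in
/-- Barycentric subdivision of singular chains. -/
def Sd (n : ℕ) : (Sing n X →₀ M) →ₗ[R] (Sing n X →₀ M) :=
  Finsupp.lsum ℕ fun σ => realize R M σ n ∘ₗ sd R M bary n ∘ₗ Finsupp.lsingle (verts n)

variable (X) in
/-- The chain homotopy between barycentric subdivision of singular chains and the identity. -/
def SdHtpy (n : ℕ) : (Sing n X →₀ M) →ₗ[R] (Sing (n + 1) X →₀ M) :=
  Finsupp.lsum ℕ fun σ => realize R M σ (n + 1) ∘ₗ sdHtpy R M bary n ∘ₗ Finsupp.lsingle (verts n)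

lemma Sd_single (n : ℕ) (σ : Sing n X) (m : M) :
    Sd R M X n (Finsupp.single σ m) =
      realize R M σ n (sd R M bary n (Finsupp.single (verts n) m)) := by
  simp [Sd]

lemma SdHtpy_single (n : ℕ) (σ : Sing n X) (m : M) :
    SdHtpy R M X n (Finsupp.single σ m) =
      realize R M σ (n + 1) (sdHtpy R M bary n (Finsupp.single (verts n) m)) := by
  simp [SdHtpy]

lemma Sd_realize {k : ℕ} (σ : Sing k X) (n : ℕ)
    (c : (Fin (n + 1) → stdSimplex ℝ (Fin (k + 1))) →₀ M) :
    Sd R M X n (realize R M σ n c) = realize R M σ n (sd R M bary n c) := by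
  induction c using Finsupp.induction_linear with
  | zero => simp
  | add c d hc hd => simp only [map_add, hc, hd]
  | single w m =>
    rw [realize_single, Sd_single, ← realize_mapDomain,
      ← sd_mapDomain R M (aff w) (fun n v => aff_bary w n v), Finsupp.mapDomain_single,
      aff_comp_verts]

lemma SdHtpy_realize {k : ℕ} (σ : Sing k X) (n : ℕ)
    (c : (Fin (n + 1) → stdSimplex ℝ (Fin (k + 1))) →₀ M) :
    SdHtpy R M X n (realize R M σ n c) = realize R M σ (n + 1) (sdHtpy R M bary n c) := by
  induction c using Finsupp.induction_linear with
  | zero => simp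
  | add c d hc hd => simp only [map_add, hc, hd]
  | single w m =>
    rw [realize_single, SdHtpy_single, ← realize_mapDomain,
      ← sdHtpy_mapDomain R M (aff w) (fun n v => aff_bary w n v), Finsupp.mapDomain_single,
      aff_comp_verts]

lemma bdS_Sd (n : ℕ) (c : Sing (n + 1) X →₀ M) :
    bdS R M X n (Sd R M X (n + 1) c) = Sd R M X n (bdS R M X n c) := by
  induction c using Finsupp.induction_linear with
  | zero => simp
  | add c d hc hd => simp only [map_add, hc, hd]
  | single σ m =>
    rw [← realize_verts R M, Sd_realize, bdS_realize, bdA_sd, bdS_realize, Sd_realize]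

lemma bdS_SdHtpy_zero (c : Sing 0 X →₀ M) :
    bdS R M X 0 (SdHtpy R M X 0 c) = c - Sd R M X 0 c := by
  induction c using Finsupp.induction_linear with
  | zero => simp
  | add c d hc hd => simp only [map_add, hc, hd]; abel
  | single σ m =>
    rw [← realize_verts R M, Sd_realize, SdHtpy_realize, bdS_realize, bdA_sdHtpy_zero, map_sub]

lemma bdS_SdHtpy (n : ℕ) (c : Sing (n + 1) X →₀ M) :
    bdS R M X (n + 1) (SdHtpy R M X (n + 1) c) =
      c - Sd R M X (n + 1) c - SdHtpy R M X n (bdS R M X n c) := by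
  induction c using Finsupp.induction_linear with
  | zero => simp
  | add c d hc hd => simp only [map_add, hc, hd]; abel
  | single σ m =>
    rw [← realize_verts R M, Sd_realize, SdHtpy_realize, bdS_realize, bdA_sdHtpy, bdS_realize,
      SdHtpy_realize, map_sub, map_sub]

lemma Sd_push (g : C(X, Y)) (n : ℕ) (c : Sing n X →₀ M) :
    Sd R M Y n (push R M g n c) = push R M g n (Sd R M X n c) := by
  induction c using Finsupp.induction_linear with
  | zero => simp
  | add c d hc hd => simp only [map_add, hc, hd]
  | single σ m => rw [push_single, Sd_single, Sd_single, push_realize]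

/-! ### Small chains -/

/-- The chains that are supported in the subset `A`. -/
def chainsIn (A : Set X) (n : ℕ) : Submodule R (Sing n X →₀ M) :=
  Finsupp.supported M R {σ | ∀ p, σ p ∈ A}

/-- The inclusion of a subspace. -/
def incl (A : Set X) : C(A, X) := ⟨Subtype.val, continuous_subtype_val⟩

variable {R M} in
lemma push_incl_mem (A : Set X) (n : ℕ) (c : Sing n A →₀ M) :
    push R M (incl A) n c ∈ chainsIn R M A n := by
  classical
  refine (Finsupp.mem_supported R _).2 fun σ hσ p => ?_
  obtain ⟨τ, -, rfl⟩ := Finset.mem_image.1 (Finsupp.mapDomain_support hσ)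
  exact (τ p).2

variable {R M} in
lemma exists_push_incl {A : Set X} {n : ℕ} {c : Sing n X →₀ M} (hc : c ∈ chainsIn R M A n) :
    ∃ c' : Sing n A →₀ M, push R M (incl A) n c' = c := by
  change c ∈ LinearMap.range (push R M (incl A) n)
  rw [← Finsupp.sum_single c]
  refine Submodule.sum_mem _ fun σ hσ => ?_
  have h : ∀ p, σ p ∈ A := (Finsupp.mem_supported R c).1 hc hσ
  exact ⟨Finsupp.single ⟨fun p => ⟨σ p, h p⟩, by fun_prop⟩ (c σ), push_single ..⟩

lemma chainsIn_inf (A B : Set X) (n : ℕ) :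
    chainsIn R M A n ⊓ chainsIn R M B n ≤ chainsIn R M (A ∩ B) n := fun _ h =>
  (Finsupp.mem_supported R _).2 fun _ hσ p =>
    ⟨(Finsupp.mem_supported R _).1 h.1 hσ p, (Finsupp.mem_supported R _).1 h.2 hσ p⟩

/-- If the interiors of `A` and `B` cover the space, then sufficiently fine subdivisions of a chain
are sums of a chain in `A` and a chain in `B`. -/
lemma exists_iterate_Sd_mem {A B : Set X} (hAB : interior A ∪ interior B = Set.univ) (n : ℕ)
    (c : Sing n X →₀ M) :
    ∃ N₀, ∀ N ≥ N₀, (Sd R M X n)^[N] c ∈ chainsIn R M A n ⊔ chainsIn R M B n := by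
  induction c using Finsupp.induction_linear with
  | zero => exact ⟨0, fun N _ => by rw [iterate_map_zero]; exact Submodule.zero_mem _⟩
  | add c d hc hd =>
    obtain ⟨N₁, h₁⟩ := hc
    obtain ⟨N₂, h₂⟩ := hd
    refine ⟨max N₁ N₂, fun N hN => ?_⟩
    rw [iterate_map_add]
    exact Submodule.add_mem _ (h₁ N (le_of_max_le_left hN)) (h₂ N (le_of_max_le_right hN))
  | single σ m =>
    obtain ⟨δ, hδ, hball⟩ := lebesgue_number_lemma_of_metric
      (s := (Set.univ : Set (stdSimplex ℝ (Fin (n + 1))))) isCompact_univ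
      (c := fun b : Bool => σ ⁻¹' (if b then interior A else interior B))
      (fun b => by
        cases b
        · exact isOpen_interior.preimage σ.continuous
        · exact isOpen_interior.preimage σ.continuous)
      (fun p _ => by
        have : σ p ∈ interior A ∪ interior B := hAB ▸ Set.mem_univ _
        rcases this with h | h
        · exact Set.mem_iUnion.2 ⟨true, h⟩
        · exact Set.mem_iUnion.2 ⟨false, h⟩)
    obtain ⟨N₀, hN₀⟩ := exists_pow_lt_of_lt_one hδ
      (show (n / (n + 1) : ℝ) < 1 from (div_lt_one (by positivity)).2 (by linarith))
    refine ⟨N₀, fun N hN => ?_⟩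
    have hlt : (n / (n + 1) : ℝ) ^ N < δ := (pow_le_pow_of_le_one (by positivity)
      ((div_le_one (by positivity)).2 (by linarith)) hN).trans_lt hN₀
    have e : (Sd R M X n)^[N] (Finsupp.single σ m) =
        realize R M σ n ((sd R M bary n)^[N] (Finsupp.single (verts n) m)) := by
      rw [← realize_verts R M]
      exact ((Function.Semiconj.iterate_right (f := realize R M σ n)
        (fun c => (Sd_realize R M σ n c).symm) N).eq _).symm
    rw [e]
    have hsupp := iterate_sd_mem_supported R M n (Finsupp.single (verts n) m) N
    generalize (sd R M bary n)^[N] (Finsupp.single (verts n) m) = c at hsupp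
    rw [← Finsupp.sum_single c, Finsupp.sum, map_sum]
    refine Submodule.sum_mem _ fun w hw => ?_
    have hdiam := (Finsupp.mem_supported R c).1 hsupp hw
    obtain ⟨b, hb⟩ := hball (w 0) (Set.mem_univ _)
    have hmem : ∀ p, σ (aff w p) ∈ if b then interior A else interior B := by
      intro p
      refine hb ?_
      rw [Metric.mem_ball, Subtype.dist_eq]
      exact (dist_aff_le w p _ _ fun j => hdiam j 0).trans_lt hlt
    rw [realize_single]
    cases b
    · exact Submodule.mem_sup_right
        (Finsupp.single_mem_supported R _ fun p => interior_subset (hmem p))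
    · exact Submodule.mem_sup_left
        (Finsupp.single_mem_supported R _ fun p => interior_subset (hmem p))

/-- The chain is a cycle; in degree `0` this is no condition. -/
def IsCyc : ∀ {n : ℕ}, (Sing n X →₀ M) → Prop
  | 0, _ => True
  | n + 1, c => bdS R M X n c = 0

end SingChains

/-! ### Homology classes and the cycles that represent them -/

namespace HomologyRep

variable {R : Type v} [CommRing R] {K L : ChainComplex (ModuleCat.{u} R) ℕ} {n : ℕ}

/-- The chain `x` is a cycle that represents the homology class `h`. -/
def Rep (x : K.X n) (h : K.homology n) : Prop :=
  ∃ z : K.cycles n, (K.iCycles n).hom z = x ∧ (K.homologyπ n).hom z = h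

lemma exists_rep (h : K.homology n) : ∃ x, Rep x h := by
  obtain ⟨z, rfl⟩ := (ModuleCat.epi_iff_surjective (K.homologyπ n)).1 inferInstance h
  exact ⟨_, z, rfl, rfl⟩

lemma Rep.d_eq_zero {x : K.X n} {h : K.homology n} (hx : Rep x h) (j : ℕ) :
    (K.d n j).hom x = 0 := by
  obtain ⟨z, rfl, -⟩ := hx
  exact congr($(K.iCycles_d n j) z)

lemma exists_class {x : K.X n} (hx : ∀ j, (K.d n j).hom x = 0) : ∃ h, Rep x h := by
  let z := ((K.sc n).moduleCatCyclesIso.inv).hom ⟨x, hx _⟩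
  exact ⟨_, z, congr($((K.sc n).moduleCatCyclesIso_inv_iCycles) ⟨x, hx _⟩), rfl⟩

lemma Rep.sub {x y : K.X n} {h k : K.homology n} (hx : Rep x h) (hy : Rep y k) :
    Rep (x - y) (h - k) := by
  obtain ⟨z, rfl, rfl⟩ := hx
  obtain ⟨w, rfl, rfl⟩ := hy
  exact ⟨z - w, map_sub _ _ _, map_sub _ _ _⟩

lemma Rep.map (f : K ⟶ L) {x : K.X n} {h : K.homology n} (hx : Rep x h) :
    Rep ((f.f n).hom x) ((HomologicalComplex.homologyMap f n).hom h) := by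
  obtain ⟨z, rfl, rfl⟩ := hx
  refine ⟨(HomologicalComplex.cyclesMap f n).hom z, ?_, ?_⟩
  · exact congr($(HomologicalComplex.cyclesMap_i f n) z)
  · exact (congr($(HomologicalComplex.homologyπ_naturality f n) z)).symm

lemma Rep.eq_zero_iff {x : K.X n} {h : K.homology n} (hx : Rep x h) :
    h = 0 ↔ ∃ y, (K.d (n + 1) n).hom y = x := by
  obtain ⟨z, rfl, rfl⟩ := hx
  have e : (K.homologyι n).hom ((K.homologyπ n).hom z) = (K.pOpcycles n).hom
      ((K.iCycles n).hom z) := congr($(K.homology_π_ι n) z)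
  have h1 : (K.homologyπ n).hom z = 0 ↔ (K.pOpcycles n).hom ((K.iCycles n).hom z) = 0 := by
    rw [← e]
    exact (map_eq_zero_iff (K.homologyι n).hom
      ((ModuleCat.mono_iff_injective (K.homologyι n)).1 inferInstance)).symm
  rw [h1]
  have h2 := (K.sc n).moduleCat_pOpcycles_eq_zero_iff ((K.iCycles n).hom z)
  refine Iff.trans h2 ?_
  change (∃ y, (K.d ((ComplexShape.down ℕ).prev n) n).hom y = _) ↔ _
  rw [ChainComplex.prev]

lemma Rep.unique {x : K.X n} {h k : K.homology n} (hx : Rep x h) (hy : Rep x k) : h = k := by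
  have := (hx.sub hy).eq_zero_iff.2 ⟨0, by simp⟩
  exact sub_eq_zero.1 this

end HomologyRep

/-! ### Singular homology in terms of finitely supported functions on singular simplices -/

namespace SingChains

open HomologyRep NovikovHomology AltChains AffineChains

variable (R : Type v) [CommRing R] (M : Type u) [AddCommGroup M] [Module R M]
variable (X : Type u) [TopologicalSpace X] {Y : Type u} [TopologicalSpace Y]

/-- The description of Mathlib's singular chains as finitely supported functions. -/
def chainsEquiv (n : ℕ) : ((chains R M).obj (TopCat.of X)).X n ≃ₗ[R] (Sing n X →₀ M) :=
  (((SSet.isColimitChainComplexXCofan (TopCat.toSSet.obj (TopCat.of X)) (ModuleCat.of R M)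
      n).coconePointUniqueUpToIso (ModuleCat.finsuppCoconeIsColimit R M _)).toLinearEquiv).trans
    (Finsupp.domLCongr (TopCat.toSSetObjEquiv (TopCat.of X) (.op (.mk n))))

variable {X}

/-- The generators of the module of singular chains. -/
def gen (n : ℕ) (σ : Sing n X) : M →ₗ[R] ((chains R M).obj (TopCat.of X)).X n :=
  ((TopCat.toSSet.obj (TopCat.of X)).ιChainComplex (R := ModuleCat.of R M)
    ((TopCat.toSSetObjEquiv (TopCat.of X) (.op (.mk n))).symm σ)).hom

lemma chainsEquiv_gen (n : ℕ) (σ : Sing n X) (m : M) :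
    chainsEquiv R M X n (gen R M n σ m) = Finsupp.single σ m := by
  have h := (SSet.isColimitChainComplexXCofan (TopCat.toSSet.obj (TopCat.of X)) (ModuleCat.of R M)
      n).comp_coconePointUniqueUpToIso_hom (ModuleCat.finsuppCoconeIsColimit R M _)
      ⟨(TopCat.toSSetObjEquiv (TopCat.of X) (.op (.mk n))).symm σ⟩
  have h' := congr($h (m : M))
  refine (congrArg (Finsupp.domLCongr (R := R)
    (TopCat.toSSetObjEquiv (TopCat.of X) (.op (.mk n)))) h').trans ?_
  refine (Finsupp.domLCongr_single _ _ _).trans ?_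
  rw [Equiv.apply_symm_apply]

lemma chainsEquiv_symm_single (n : ℕ) (σ : Sing n X) (m : M) :
    (chainsEquiv R M X n).symm (Finsupp.single σ m) = gen R M n σ m := by
  rw [LinearEquiv.symm_apply_eq, chainsEquiv_gen]

lemma chainsEquiv_map (g : C(X, Y)) (n : ℕ) (c : ((chains R M).obj (TopCat.of X)).X n) :
    chainsEquiv R M Y n ((((chains R M).map (TopCat.ofHom g)).f n).hom c) =
      push R M g n (chainsEquiv R M X n c) := by
  obtain ⟨c, rfl⟩ := (chainsEquiv R M X n).symm.surjective c
  rw [LinearEquiv.apply_symm_apply]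
  induction c using Finsupp.induction_linear with
  | zero => simp
  | add c d hc hd => simp only [map_add, hc, hd]
  | single σ m =>
    rw [chainsEquiv_symm_single, push_single, ← chainsEquiv_gen R M]
    congr 1
    exact congr($(SSet.ι_chainComplexMap_f _ _ (TopCat.toSSet.map (TopCat.ofHom g))
      (ModuleCat.of R M) ((TopCat.toSSetObjEquiv (TopCat.of X) (.op (.mk n))).symm σ)) m)

lemma toSSetObjEquiv_δ (n : ℕ) (i : Fin (n + 2)) (σ : Sing (n + 1) X) :
    (TopCat.toSSet.obj (TopCat.of X)).δ i
        ((TopCat.toSSetObjEquiv (TopCat.of X) (.op (.mk (n + 1)))).symm σ) =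
      (TopCat.toSSetObjEquiv (TopCat.of X) (.op (.mk n))).symm (faceS X n i σ) := by
  rw [Equiv.eq_symm_apply]
  ext p
  change σ (stdSimplex.map _ p) = σ (aff _ p)
  congr 1
  have h := aff_map (verts (n + 1)) i.succAbove p
  rw [aff_vertex] at h
  exact h

lemma sum_zsmul_hom_apply {A B : ModuleCat.{u} R} {k : ℕ} (a : Fin k → ℤ) (g : Fin k → (A ⟶ B))
    (x : A) : (∑ i, a i • g i).hom x = ∑ i, a i • (g i).hom x := by
  simp [ModuleCat.hom_sum, LinearMap.sum_apply]

lemma d_gen (n : ℕ) (σ : Sing (n + 1) X) (m : M) :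
    (((chains R M).obj (TopCat.of X)).d (n + 1) n).hom (gen R M (n + 1) σ m) =
      ∑ i : Fin (n + 2), (-1 : ℤ) ^ (i : ℕ) • gen R M n (faceS X n i σ) m := by
  have h := SSet.ιChainComplex_d (TopCat.toSSet.obj (TopCat.of X)) (R := ModuleCat.of R M)
    ((TopCat.toSSetObjEquiv (TopCat.of X) (.op (.mk (n + 1)))).symm σ)
  have h' := h.trans (Finset.sum_congr rfl fun i _ => congrArg (fun y => (-1 : ℤ) ^ (i : ℕ) •
    (TopCat.toSSet.obj (TopCat.of X)).ιChainComplex (R := ModuleCat.of R M) y)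
    (toSSetObjEquiv_δ n i σ))
  exact (congr(ModuleCat.Hom.hom $h' m)).trans (sum_zsmul_hom_apply R _ _ _)

lemma chainsEquiv_d (n : ℕ) (c : ((chains R M).obj (TopCat.of X)).X (n + 1)) :
    chainsEquiv R M X n ((((chains R M).obj (TopCat.of X)).d (n + 1) n).hom c) =
      bdS R M X n (chainsEquiv R M X (n + 1) c) := by
  obtain ⟨c, rfl⟩ := (chainsEquiv R M X (n + 1)).symm.surjective c
  rw [LinearEquiv.apply_symm_apply]
  induction c using Finsupp.induction_linear with
  | zero => simp
  | add c d hc hd => simp only [map_add, hc, hd]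
  | single σ m =>
    rw [chainsEquiv_symm_single, bd_single, d_gen, map_sum]
    refine Finset.sum_congr rfl fun i _ => ?_
    rw [map_zsmul, chainsEquiv_gen]

variable {R M}

/-- The finitely supported function `c` on singular simplices represents the class `h`. -/
def SRep {n : ℕ} (c : Sing n X →₀ M) (h : H R M n X) : Prop :=
  Rep (K := (chains R M).obj (TopCat.of X)) ((chainsEquiv R M X n).symm c) h

variable {n : ℕ}

lemma exists_sRep (h : H R M n X) : ∃ c : Sing n X →₀ M, SRep c h := by
  obtain ⟨x, hx⟩ := exists_rep (K := (chains R M).obj (TopCat.of X)) h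
  exact ⟨chainsEquiv R M X n x, by rwa [SRep, LinearEquiv.symm_apply_apply]⟩

lemma SRep.isCyc {c : Sing n X →₀ M} {h : H R M n X} (hc : SRep c h) : IsCyc R M c := by
  cases n with
  | zero => trivial
  | succ n =>
    have := hc.d_eq_zero n
    have := congrArg (chainsEquiv R M X n) this
    rwa [chainsEquiv_d, map_zero, LinearEquiv.apply_symm_apply] at this

lemma exists_sClass {c : Sing n X →₀ M} (hc : IsCyc R M c) : ∃ h : H R M n X, SRep c h := by
  refine exists_class fun j => ?_
  by_cases hj : j + 1 = n
  · subst hj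
    apply (chainsEquiv R M X j).injective
    rw [chainsEquiv_d, map_zero, LinearEquiv.apply_symm_apply]
    exact hc
  · rw [((chains R M).obj (TopCat.of X)).shape n j hj]
    rfl

lemma SRep.sub {c d : Sing n X →₀ M} {h k : H R M n X} (hc : SRep c h) (hd : SRep d k) :
    SRep (c - d) (h - k) := by
  rw [SRep, map_sub]
  exact Rep.sub hc hd

lemma SRep.map (g : C(X, Y)) {c : Sing n X →₀ M} {h : H R M n X} (hc : SRep c h) :
    SRep (push R M g n c) (Hmap R M n g h) := by
  have e : (chainsEquiv R M Y n).symm (push R M g n c) =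
      (((chains R M).map (TopCat.ofHom g)).f n).hom ((chainsEquiv R M X n).symm c) := by
    rw [LinearEquiv.symm_apply_eq, chainsEquiv_map, LinearEquiv.apply_symm_apply]
  rw [SRep, e]
  exact Rep.map ((chains R M).map (TopCat.ofHom g)) hc

lemma SRep.eq_zero_iff {c : Sing n X →₀ M} {h : H R M n X} (hc : SRep c h) :
    h = 0 ↔ ∃ e, bdS R M X n e = c := by
  refine (Rep.eq_zero_iff hc).trans ⟨fun ⟨y, hy⟩ => ⟨chainsEquiv R M X (n + 1) y, ?_⟩,
    fun ⟨e, he⟩ => ⟨(chainsEquiv R M X (n + 1)).symm e, ?_⟩⟩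
  · rw [← chainsEquiv_d, hy, LinearEquiv.apply_symm_apply]
  · rw [LinearEquiv.eq_symm_apply, chainsEquiv_d, LinearEquiv.apply_symm_apply, he]

lemma SRep.unique {c : Sing n X →₀ M} {h k : H R M n X} (hc : SRep c h) (hd : SRep c k) : h = k :=
  Rep.unique hc hd

end SingChains

/-! ### Functoriality, homotopy invariance and the Mayer–Vietoris property -/

namespace SingChains

open HomologyRep NovikovHomology AltChains AffineChains

variable {R : Type v} [CommRing R] {M : Type u} [AddCommGroup M] [Module R M]
variable {X Y Z P Q D : Type u} [TopologicalSpace X] [TopologicalSpace Y] [TopologicalSpace Z]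
  [TopologicalSpace P] [TopologicalSpace Q] [TopologicalSpace D] {n : ℕ}

lemma Hmap_id_apply (h : H R M n X) : Hmap R M n (ContinuousMap.id X) h = h := by
  obtain ⟨c, hc⟩ := exists_sRep h
  have h2 := hc.map (ContinuousMap.id X)
  have e : push R M (ContinuousMap.id X) n c = c := Finsupp.mapDomain_id
  rw [e] at h2
  exact h2.unique hc

lemma Hmap_comp_apply (g : C(X, Y)) (k : C(Y, Z)) (h : H R M n X) :
    Hmap R M n (k.comp g) h = Hmap R M n k (Hmap R M n g h) := by
  obtain ⟨c, hc⟩ := exists_sRep h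
  have h2 := hc.map (k.comp g)
  rw [push_comp] at h2
  exact h2.unique ((hc.map g).map k)

lemma Hmap_congr_of_homotopy {g k : C(X, Y)} (F : g.Homotopy k) (h : H R M n X) :
    Hmap R M n g h = Hmap R M n k h := by
  have F' : TopCat.Homotopy (TopCat.ofHom g) (TopCat.ofHom k) := F
  exact congr($(F'.congr_homologyMap_singularChainComplexFunctor (ModuleCat.of R M) n) h)

lemma Hmap_bijective_of_inverse {g : C(X, Y)} {k : C(Y, X)} (h₁ : k.comp g = .id X)
    (h₂ : g.comp k = .id Y) : Function.Bijective (Hmap R M n g) := by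
  refine Function.bijective_iff_has_inverse.2 ⟨Hmap R M n k, fun x => ?_, fun x => ?_⟩
  · rw [← Hmap_comp_apply, h₁, Hmap_id_apply]
  · rw [← Hmap_comp_apply, h₂, Hmap_id_apply]

lemma IsCyc.sub_bdS {c : Sing n X →₀ M} (hc : IsCyc R M c) (e : Sing (n + 1) X →₀ M) :
    IsCyc R M (c - bdS R M X n e) := by
  cases n with
  | zero => trivial
  | succ n =>
    have h : bdS R M X n (bdS R M X (n + 1) e) = 0 := by
      obtain ⟨x, rfl⟩ := (chainsEquiv R M X (n + 2)).surjective e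
      rw [← chainsEquiv_d, ← chainsEquiv_d]
      have := congr($(((chains R M).obj (TopCat.of X)).d_comp_d (n + 2) (n + 1) n) x)
      exact (congrArg _ this).trans (map_zero _)
    change bdS R M X n (c - _) = 0
    rw [map_sub, h, sub_zero]
    exact hc

lemma IsCyc.of_push {g : C(X, Y)} (hg : Function.Injective g) {c : Sing n X →₀ M}
    (hc : IsCyc R M (push R M g n c)) : IsCyc R M c := by
  cases n with
  | zero => trivial
  | succ n =>
    apply push_injective R M hg n
    rw [← bdS_push, map_zero]
    exact hc

lemma SRep.sub_bdS {c : Sing n X →₀ M} {h : H R M n X} (hc : SRep c h)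
    (e : Sing (n + 1) X →₀ M) : SRep (c - bdS R M X n e) h := by
  obtain ⟨h', hc'⟩ := exists_sClass (hc.isCyc.sub_bdS e)
  have : h - h' = 0 := (hc.sub hc').eq_zero_iff.2 ⟨e, by abel⟩
  rwa [sub_eq_zero.1 this]

lemma SRep.Sd {c : Sing n X →₀ M} {h : H R M n X} (hc : SRep c h) : SRep (Sd R M X n c) h := by
  have := hc.sub_bdS (SdHtpy R M X n c)
  cases n with
  | zero => rwa [bdS_SdHtpy_zero, sub_sub_cancel] at this
  | succ n =>
    have h0 : bdS R M X n c = 0 := hc.isCyc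
    rwa [bdS_SdHtpy, h0, map_zero, sub_zero, sub_sub_cancel] at this

lemma SRep.iterate_Sd {c : Sing n X →₀ M} {h : H R M n X} (hc : SRep c h) (N : ℕ) :
    SRep ((SingChains.Sd R M X n)^[N] c) h := by
  induction N with
  | zero => exact hc
  | succ N ih =>
    rw [Function.iterate_succ_apply']
    exact ih.Sd

lemma iterate_Sd_push (g : C(X, Y)) (c : Sing n X →₀ M) (N : ℕ) :
    (Sd R M Y n)^[N] (push R M g n c) = push R M g n ((Sd R M X n)^[N] c) :=
  ((Function.Semiconj.iterate_right (f := push R M g n)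
    (fun c => (Sd_push R M g n c).symm) N).eq c).symm

lemma iterate_Sd_bdS (c : Sing (n + 1) X →₀ M) (N : ℕ) :
    (Sd R M X n)^[N] (bdS R M X n c) = bdS R M X n ((Sd R M X (n + 1))^[N] c) :=
  ((Function.Semiconj.iterate_right (f := bdS R M X n)
    (fun c => bdS_Sd R M n c) N).eq c).symm

lemma push_mem_chainsIn (g : C(X, Y)) (c : Sing n X →₀ M) :
    push R M g n c ∈ chainsIn R M (Set.range g) n := by
  classical
  refine (Finsupp.mem_supported R _).2 fun σ hσ p => ?_
  obtain ⟨τ, -, rfl⟩ := Finset.mem_image.1 (Finsupp.mapDomain_support hσ)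
  exact ⟨τ p, rfl⟩

lemma chainsIn_mono {A B : Set X} (h : A ⊆ B) (n : ℕ) : chainsIn R M A n ≤ chainsIn R M B n :=
  Finsupp.supported_mono fun _ hσ p => h (hσ p)

lemma exists_push_eq {g : C(X, Y)} (hg : Topology.IsEmbedding g) {c : Sing n Y →₀ M}
    (hc : c ∈ chainsIn R M (Set.range g) n) : ∃ c' : Sing n X →₀ M, push R M g n c' = c := by
  change c ∈ LinearMap.range (push R M g n)
  rw [← Finsupp.sum_single c]
  refine Submodule.sum_mem _ fun σ hσ => ?_
  have h : ∀ p, σ p ∈ Set.range g := (Finsupp.mem_supported R c).1 hc hσ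
  choose τ hτ using h
  have hc : Continuous τ := by
    rw [hg.continuous_iff]
    have : g ∘ τ = σ := funext hτ
    rw [this]
    exact σ.continuous
  refine ⟨Finsupp.single ⟨τ, hc⟩ (c σ), ?_⟩
  rw [push_single]
  congr 1
  ext p
  exact hτ p

/-- The Mayer–Vietoris property of a cover by the interiors of two subspaces. -/
theorem exists_of_interior_cover {i : C(P, Y)} {j : C(Q, Y)} {k : C(D, P)} {l : C(D, Q)}
    (hi : Topology.IsEmbedding i) (hj : Topology.IsEmbedding j)
    (hk : Topology.IsEmbedding k) (hkl : i.comp k = j.comp l)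
    (hr : Set.range i ∩ Set.range j ⊆ Set.range (i.comp k))
    (hcov : interior (Set.range i) ∪ interior (Set.range j) = Set.univ)
    (a : H R M n P) (b : H R M n Q) (hab : Hmap R M n i a = Hmap R M n j b) :
    ∃ w : H R M n D, Hmap R M n k w = a ∧ Hmap R M n l w = b := by
  obtain ⟨ca, ha⟩ := exists_sRep a
  obtain ⟨cb, hb⟩ := exists_sRep b
  obtain ⟨e, he⟩ := ((ha.map i).sub (hb.map j)).eq_zero_iff.1 (sub_eq_zero.2 hab)
  obtain ⟨N, hN⟩ := exists_iterate_Sd_mem R M hcov (n + 1) e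
  obtain ⟨e₁, h₁, e₂, h₂, hsum⟩ := Submodule.mem_sup.1 (hN N le_rfl)
  obtain ⟨e₁, rfl⟩ := exists_push_eq hi h₁
  obtain ⟨e₂, rfl⟩ := exists_push_eq hj h₂
  have ha' := (ha.iterate_Sd N).sub_bdS e₁
  have hb' := (hb.iterate_Sd N).sub_bdS (-e₂)
  set x := (Sd R M P n)^[N] ca - bdS R M P n e₁ with hx
  set y := (Sd R M Q n)^[N] cb - bdS R M Q n (-e₂) with hy
  have hxy : push R M i n x = push R M j n y := by
    have h := congrArg (Sd R M Y n)^[N] he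
    rw [iterate_Sd_bdS, ← hsum, iterate_map_sub, iterate_Sd_push, iterate_Sd_push, map_add,
      bdS_push, bdS_push] at h
    rw [hx, hy, map_sub, map_sub, map_neg, map_neg, sub_neg_eq_add, sub_eq_iff_eq_add, add_assoc,
      add_comm (push R M j n (bdS R M Q n e₂)), h]
    abel
  have hmem : push R M i n x ∈ chainsIn R M (Set.range (i.comp k)) n :=
    chainsIn_mono hr n (chainsIn_inf R M _ _ n
      ⟨push_mem_chainsIn i x, hxy ▸ push_mem_chainsIn j y⟩)
  obtain ⟨w, hw⟩ := exists_push_eq (g := i.comp k) (hi.comp hk) hmem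
  have hwx : push R M k n w = x := by
    apply push_injective R M hi.injective n
    rw [← push_comp, hw]
  have hwy : push R M l n w = y := by
    apply push_injective R M hj.injective n
    rw [← push_comp, ← hkl, hw, hxy]
  have hcyc : IsCyc R M w := IsCyc.of_push hk.injective (by rw [hwx]; exact ha'.isCyc)
  obtain ⟨h, hh⟩ := exists_sClass hcyc
  refine ⟨h, ?_, ?_⟩
  · have := hh.map k
    rw [hwx] at this
    exact this.unique ha'
  · have := hh.map l
    rw [hwy] at this
    exact this.unique hb'

/-- The inclusion of a subset in a larger one. -/
def inclSub {A B : Set Y} (h : A ⊆ B) : C(A, B) := ⟨Set.inclusion h, continuous_inclusion h⟩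

lemma isEmbedding_inclSub {A B : Set Y} (h : A ⊆ B) : Topology.IsEmbedding (inclSub h) :=
  .inclusion h

lemma isEmbedding_incl (A : Set Y) : Topology.IsEmbedding (incl A) := .subtypeVal

lemma range_incl (A : Set Y) : Set.range (incl A) = A := Subtype.range_val

lemma isOpen_setOf_forall_mem {I : Type*} [TopologicalSpace I] [CompactSpace I] {W : Set (X × I)}
    (hW : IsOpen W) : IsOpen {x | ∀ t, (x, t) ∈ W} := by
  have : {x | ∀ t, (x, t) ∈ W} = (Prod.fst '' Wᶜ)ᶜ := by
    ext x
    simp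
  rw [this]
  exact (isClosedMap_fst_of_compactSpace _ hW.isClosed_compl).isOpen_compl

section NDR

variable {A B L U : Set Y} (hA : IsClosed A) (hB : IsClosed B) (hAB : A ∪ B = Set.univ)
  (hL : L = A ∩ B) (hLU : L ⊆ U) (h : C(U × unitInterval, Y))
  (h0 : ∀ x : U, h (x, 0) = x) (h1 : ∀ x : U, h (x, 1) ∈ L)
  (hfix : ∀ (x : U) (t : unitInterval), (x : Y) ∈ L → h (x, t) = x)

include hA hB hAB hL hLU h1 hfix in
/-- The end of the deformation of `U` into `A ∩ B` extends the identity of `A` to a retraction of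
`A ∪ U` to `A`. -/
lemma exists_retraction : ∃ r : C((A ∪ U : Set Y), A),
    (∀ y : (A ∪ U : Set Y), (y : Y) ∈ A → (r y : Y) = y) ∧
    ∀ (y : (A ∪ U : Set Y)) (hy : (y : Y) ∈ U), (y : Y) ∉ A → (r y : Y) = h (⟨y, hy⟩, 1) := by
  classical
  have hLA : L ⊆ A := hL ▸ Set.inter_subset_left
  let r : (A ∪ U : Set Y) → A := fun y =>
    if hy : (y : Y) ∈ A then ⟨y, hy⟩ else ⟨h (⟨y, y.2.resolve_left hy⟩, 1), hLA (h1 _)⟩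
  have rA : ∀ y : (A ∪ U : Set Y), (y : Y) ∈ A → (r y : Y) = y := fun y hy => by simp [r, hy]
  have rU : ∀ (y : (A ∪ U : Set Y)) (hy : (y : Y) ∈ U), (y : Y) ∉ A →
      (r y : Y) = h (⟨y, hy⟩, 1) := fun y hy hyA => by simp [r, hyA]
  have hBU : ∀ y : (A ∪ U : Set Y), (y : Y) ∈ B → (y : Y) ∈ U := fun y hy =>
    y.2.elim (fun hyA => hLU (hL ▸ ⟨hyA, hy⟩)) id
  have hr : Continuous r := by
    refine Continuous.subtype_mk (f := fun y => (r y : Y)) ?_ fun y => (r y).2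
    rw [← continuousOn_univ]
    have hcov : (Subtype.val ⁻¹' A ∪ Subtype.val ⁻¹' B : Set (A ∪ U : Set Y)) = Set.univ := by
      rw [← Set.preimage_union, hAB, Set.preimage_univ]
    rw [← hcov]
    refine ContinuousOn.union_of_isClosed ?_ ?_ (hA.preimage continuous_subtype_val)
      (hB.preimage continuous_subtype_val)
    · exact continuous_subtype_val.continuousOn.congr fun y hy => rA y hy
    · rw [continuousOn_iff_continuous_domRestrict]
      have : (Subtype.val ⁻¹' B : Set (A ∪ U : Set Y)).domRestrict (fun y => (r y : Y)) =
          fun y => h (⟨y.1.1, hBU y.1 y.2⟩, 1) := by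
        funext y
        by_cases hyA : (y.1 : Y) ∈ A
        · exact (rA _ hyA).trans (hfix ⟨y.1.1, hBU y.1 y.2⟩ 1 (hL ▸ ⟨hyA, y.2⟩)).symm
        · exact rU _ _ hyA
      rw [this]
      fun_prop
  exact ⟨⟨r, hr⟩, rA, rU⟩

/-- The end of the deformation, on a smaller set `U'`. -/
def deformationEnd {U' : Set Y} (hU' : U' ⊆ U) : C(U', L) where
  toFun x := ⟨h (⟨x, hU' x.2⟩, 1), h1 _⟩
  continuous_toFun := by fun_prop

include hA hB hAB hL hLU h0 hfix in
/-- If a class `a` of `A` agrees in `A ∪ U'` with a class `w` of `U'`, then it is the image of the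
class of `A ∩ B` that is obtained from `w` by the deformation. -/
lemma Hmap_deformationEnd {U' : Set Y} (hU' : U' ⊆ U)
    (hstay : ∀ (x : U) (t : unitInterval), (x : Y) ∈ U' → h (x, t) ∈ U) (hLA : L ⊆ A)
    (w : H R M n U') (a : H R M n A)
    (hwa : Hmap R M n (inclSub (B := A ∪ U') Set.subset_union_right) w =
      Hmap R M n (inclSub Set.subset_union_left) a) :
    Hmap R M n (inclSub hLA) (Hmap R M n (deformationEnd h h1 hU') w) = a := by
  obtain ⟨r, rA, rU⟩ := exists_retraction hA hB hAB hL hLU h h1 hfix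
  have hsub : A ∪ U' ⊆ A ∪ U := Set.union_subset_union_right A hU'
  have e1 : (r.comp (inclSub hsub)).comp (inclSub Set.subset_union_left) = .id A := by
    ext y
    exact rA _ y.2
  have hw := congrArg (Hmap R M n (r.comp (inclSub hsub))) hwa
  rw [← Hmap_comp_apply, ← Hmap_comp_apply, e1, Hmap_id_apply] at hw
  rw [← Hmap_comp_apply, ← hw]
  symm
  refine Hmap_congr_of_homotopy
    { toFun := fun p : unitInterval × U' =>
        r ⟨h (⟨p.2.1, hU' p.2.2⟩, p.1), Or.inr (hstay _ _ p.2.2)⟩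
      continuous_toFun := by fun_prop
      map_zero_left := fun x => ?_
      map_one_left := fun x => ?_ } w
  · exact congrArg r (Subtype.ext (h0 _))
  · exact Subtype.ext (rA _ (hLA (h1 _)))

include hA hB hAB hL hLU h0 h1 hfix in
/-- The Mayer–Vietoris property of two closed sets whose intersection is a neighborhood deformation
retract. -/
theorem exists_of_isClosed_cover (hU : IsOpen U) (hLA : L ⊆ A) (hLB : L ⊆ B)
    (a : H R M n A) (b : H R M n B) (hab : Hmap R M n (incl A) a = Hmap R M n (incl B) b) :
    ∃ w : H R M n L, Hmap R M n (inclSub hLA) w = a ∧ Hmap R M n (inclSub hLB) w = b := by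
  let U' : Set Y := Subtype.val '' {x : U | ∀ t : unitInterval, (x, t) ∈ h ⁻¹' U}
  have hU'o : IsOpen U' :=
    hU.isOpenMap_subtype_val _ (isOpen_setOf_forall_mem (hU.preimage h.continuous))
  have hU' : U' ⊆ U := by
    rintro _ ⟨x, -, rfl⟩
    exact x.2
  have hstay : ∀ (x : U) (t : unitInterval), (x : Y) ∈ U' → h (x, t) ∈ U := by
    rintro x t ⟨y, hy, hyx⟩
    rw [← Subtype.ext hyx]
    exact hy t
  have hLU' : L ⊆ U' := fun y hy => ⟨⟨y, hLU hy⟩, fun t => by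
    change h (_, t) ∈ U
    rw [hfix ⟨y, hLU hy⟩ t hy]
    exact hLU hy, rfl⟩
  have hcov : interior (A ∪ U') ∪ interior (B ∪ U') = Set.univ := by
    refine Set.eq_univ_of_forall fun y => ?_
    by_cases hyA : y ∈ A
    · by_cases hyB : y ∈ B
      · exact .inl (interior_mono Set.subset_union_right
          (hU'o.interior_eq.symm ▸ hLU' (hL ▸ ⟨hyA, hyB⟩)))
      · refine .inl (mem_interior.2 ⟨Bᶜ, fun z hz => .inl ?_, hB.isOpen_compl, hyB⟩)
        exact (hAB.symm ▸ Set.mem_univ z : z ∈ A ∪ B).resolve_right hz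
    · refine .inr (mem_interior.2 ⟨Aᶜ, fun z hz => .inl ?_, hA.isOpen_compl, hyA⟩)
      exact (hAB.symm ▸ Set.mem_univ z : z ∈ A ∪ B).resolve_left hz
  obtain ⟨w, hwa, hwb⟩ := exists_of_interior_cover (R := R) (M := M) (n := n)
    (i := incl (A ∪ U')) (j := incl (B ∪ U'))
    (k := inclSub (A := U') Set.subset_union_right)
    (l := inclSub (A := U') Set.subset_union_right)
    (isEmbedding_incl _) (isEmbedding_incl _) (isEmbedding_inclSub _) rfl
    (by
      rw [range_incl, range_incl]
      rintro y ⟨hyA, hyB⟩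
      have hy : y ∈ U' := by
        rcases hyA with hyA | hyA
        · rcases hyB with hyB | hyB
          · exact hLU' (hL ▸ ⟨hyA, hyB⟩)
          · exact hyB
        · exact hyA
      exact ⟨⟨y, hy⟩, rfl⟩)
    (by rw [range_incl, range_incl]; exact hcov)
    (Hmap R M n (inclSub Set.subset_union_left) a) (Hmap R M n (inclSub Set.subset_union_left) b)
    (by
      rw [← Hmap_comp_apply, ← Hmap_comp_apply]
      exact hab)
  exact ⟨Hmap R M n (deformationEnd h h1 hU') w,
    Hmap_deformationEnd hA hB hAB hL hLU h h0 h1 hfix hU' hstay hLA w a hwa,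
    Hmap_deformationEnd hB hA (Set.union_comm A B ▸ hAB) (Set.inter_comm A B ▸ hL) hLU h h0 h1
      hfix hU' hstay hLB w b hwb⟩

end NDR

/-! ### Homology has compact supports -/

section Compact

variable {J : Type*} [Preorder J] [IsDirectedOrder J] [Nonempty J] {A : J → Set Y}
  (hA : Monotone A) (hK : ∀ K : Set Y, IsCompact K → ∃ j, K ⊆ A j)

include hA hK in
lemma exists_mem_chainsIn (c : Sing n Y →₀ M) : ∃ j, c ∈ chainsIn R M (A j) n := by
  induction c using Finsupp.induction_linear with
  | zero => exact ⟨Classical.arbitrary J, Submodule.zero_mem _⟩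
  | add c d hc hd =>
    obtain ⟨j, hj⟩ := hc
    obtain ⟨k, hk⟩ := hd
    obtain ⟨l, hjl, hkl⟩ := exists_ge_ge j k
    exact ⟨l, Submodule.add_mem _ (chainsIn_mono (hA hjl) n hj) (chainsIn_mono (hA hkl) n hk)⟩
  | single σ m =>
    obtain ⟨j, hj⟩ := hK (Set.range σ) (isCompact_range σ.continuous)
    exact ⟨j, Finsupp.single_mem_supported R m fun p => hj ⟨p, rfl⟩⟩

include hA hK in
/-- Every homology class comes from a member of an exhaustion. -/
lemma exists_Hmap_incl_eq (x : H R M n Y) : ∃ (j : J) (y : H R M n (A j)),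
    Hmap R M n (incl (A j)) y = x := by
  obtain ⟨c, hc⟩ := exists_sRep x
  obtain ⟨j, hj⟩ := exists_mem_chainsIn (R := R) hA hK c
  obtain ⟨c, rfl⟩ := exists_push_incl hj
  obtain ⟨y, hy⟩ := exists_sClass (hc.isCyc.of_push Subtype.val_injective)
  exact ⟨j, y, (hy.map _).unique hc⟩

include hA hK in
/-- A homology class that vanishes in the space vanishes in a member of an exhaustion. -/
lemma exists_Hmap_inclSub_eq_zero (i : J) (y : H R M n (A i))
    (hy : Hmap R M n (incl (A i)) y = 0) :
    ∃ (j : J) (hij : i ≤ j), Hmap R M n (inclSub (hA hij)) y = 0 := by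
  obtain ⟨c, hc⟩ := exists_sRep y
  obtain ⟨e, he⟩ := (hc.map _).eq_zero_iff.1 hy
  obtain ⟨k, hk⟩ := exists_mem_chainsIn (R := R) hA hK e
  obtain ⟨j, hij, hkj⟩ := exists_ge_ge i k
  obtain ⟨e, rfl⟩ := exists_push_incl (chainsIn_mono (hA hkj) _ hk)
  refine ⟨j, hij, (hc.map _).eq_zero_iff.2 ⟨e, ?_⟩⟩
  apply push_injective R M (g := incl (A j)) Subtype.val_injective n
  rw [← bdS_push, he, ← push_comp]
  rfl

end Compact

end SingChains

/-! ### The kernel of the map to Novikov homology -/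

namespace SingChains

open HomologyRep NovikovHomology AltChains AffineChains

section Limits

variable {R : Type v} [CommRing R] {J : Type} [Category.{0} J]
  (F : J ⥤ ChainComplex (ModuleCat.{u} R) ℕ) (n : ℕ)

/-- A compatible family of elements determines a unique element of a limit of complexes. -/
lemma existsUnique_limit (y : ∀ j, (F.obj j).X n)
    (hy : ∀ {j j' : J} (i : j ⟶ j'), ((F.map i).f n).hom (y j) = y j') :
    ∃! z : (limit F).X n, ∀ j, ((limit.π F j).f n).hom z = y j :=
  (Types.isLimit_iff _).1 ⟨isLimitOfPreserves
    (HomologicalComplex.eval _ _ n ⋙ forget (ModuleCat.{u} R)) (limit.isLimit F)⟩ y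
    fun {_ _} i => hy i

lemma limit_ext {z w : (limit F).X n}
    (h : ∀ j, ((limit.π F j).f n).hom z = ((limit.π F j).f n).hom w) : z = w := by
  refine (existsUnique_limit F n (fun j => ((limit.π F j).f n).hom w) ?_).unique h fun _ => rfl
  intro j j' i
  have := congrArg (fun g => (g.f n).hom w) (limit.w F i)
  exact this

end Limits

variable {R : Type v} [CommRing R] {M : Type u} [AddCommGroup M] [Module R M]
variable {Y : Type u} [TopologicalSpace Y] {n : ℕ}

variable (R M) in
/-- The projection from chains to relative chains. -/
def toRel (A : Set Y) (n : ℕ) : (Sing n Y →₀ M) →ₗ[R] ((relChains R M Y).obj A).X n :=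
  (((toRelChains R M Y).app A).f n).hom ∘ₗ (chainsEquiv R M Y n).symm.toLinearMap

lemma toRel_surjective (A : Set Y) (n : ℕ) : Function.Surjective (toRel R M A n) := by
  have : Epi ((cokernel.π ((chainsIncl R M Y).app A)).f n) := inferInstance
  exact ((ModuleCat.epi_iff_surjective _).1 this).comp (chainsEquiv R M Y n).symm.surjective

lemma toRel_eq_zero_iff (A : Set Y) (c : Sing n Y →₀ M) :
    toRel R M A n c = 0 ↔ c ∈ chainsIn R M A n := by
  have hpush : ∀ y : ((chains R M).obj (TopCat.of A)).X n,
      (((chainsIncl R M Y).app A).f n).hom y =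
        (chainsEquiv R M Y n).symm (push R M (incl A) n (chainsEquiv R M A n y)) := by
    intro y
    rw [LinearEquiv.eq_symm_apply, ← chainsEquiv_map]
    rfl
  constructor
  · intro h
    have ex := (ShortComplex.exact_cokernel ((chainsIncl R M Y).app A)).map
      (HomologicalComplex.eval _ _ n)
    obtain ⟨y, hy⟩ := (ShortComplex.moduleCat_exact_iff _).1 ex _ h
    have := (hpush y).symm.trans hy
    rw [← (chainsEquiv R M Y n).symm.injective this]
    exact push_incl_mem A n _
  · intro h
    obtain ⟨c, rfl⟩ := exists_push_incl h
    obtain ⟨y, rfl⟩ := (chainsEquiv R M A n).surjective c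
    change (((toRelChains R M Y).app A).f n).hom ((chainsEquiv R M Y n).symm _) = 0
    rw [← hpush]
    have := cokernel.condition ((chainsIncl R M Y).app A)
    exact congrArg (fun g => (g.f n).hom y) this

lemma toRel_bdS (A : Set Y) (c : Sing (n + 1) Y →₀ M) :
    toRel R M A n (bdS R M Y n c) =
      (((relChains R M Y).obj A).d (n + 1) n).hom (toRel R M A (n + 1) c) := by
  obtain ⟨c, rfl⟩ := (chainsEquiv R M Y (n + 1)).surjective c
  have h := ((toRelChains R M Y).app A).comm (n + 1) n
  simp only [toRel, LinearMap.comp_apply, LinearEquiv.coe_coe, LinearEquiv.symm_apply_apply]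
  rw [← chainsEquiv_d, LinearEquiv.symm_apply_apply]
  exact (congr($(h).hom c)).symm

lemma toRel_map {A B : Set Y} (i : A ⟶ B) (c : Sing n Y →₀ M) :
    (((relChains R M Y).map i).f n).hom (toRel R M A n c) = toRel R M B n c := by
  have h := (toRelChains R M Y).naturality i
  have h2 := congrArg (fun g => (g.f n).hom ((chainsEquiv R M Y n).symm c)) h
  exact h2.symm

variable {J : Type} [Category.{0} J] (A : J ⥤ Set Y)

lemma π_toLimit (j : J) (c : Sing n Y →₀ M) :
    ((limit.π (A ⋙ relChains R M Y) j).f n).hom (((toLimit R M A).f n).hom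
      ((chainsEquiv R M Y n).symm c)) = toRel R M (A.obj j) n c := by
  have h : toLimit R M A ≫ limit.π (A ⋙ relChains R M Y) j = (toRelChains R M Y).app (A.obj j) :=
    limit.lift_π _ _
  exact congrArg (fun g => (g.f n).hom ((chainsEquiv R M Y n).symm c)) h

variable {A} (a : ℕ → J) (s : ∀ k, a (k + 1) ⟶ a k)

/-- The inclusions of the members of a decreasing sequence of subspaces. -/
abbrev stepIncl (k : ℕ) : C(A.obj (a (k + 1)), A.obj (a k)) := inclSub (leOfHom (A.map (s k)))

/-- A homology class that vanishes in the limit of the relative chain complexes comes from a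
compatible sequence of classes of the subspaces. -/
lemma exists_seq_of_toLimit_eq_zero (x : H R M n Y)
    (hx : (HomologicalComplex.homologyMap (toLimit R M A) n).hom x = 0) :
    ∃ y : ∀ k, H R M n (A.obj (a k)),
      (∀ k, Hmap R M n (stepIncl a s k) (y (k + 1)) = y k) ∧
        ∀ k, Hmap R M n (incl (A.obj (a k))) (y k) = x := by
  obtain ⟨c, hc⟩ := exists_sRep x
  obtain ⟨w, hw⟩ := (Rep.map (toLimit R M A) hc).eq_zero_iff.1 hx
  choose e he using fun k => toRel_surjective (R := R) (M := M) (A.obj (a k)) (n + 1)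
    (((limit.π (A ⋙ relChains R M Y) (a k)).f (n + 1)).hom w)
  have hmem : ∀ k, c - bdS R M Y n (e k) ∈ chainsIn R M (A.obj (a k)) n := by
    intro k
    rw [← toRel_eq_zero_iff, map_sub, sub_eq_zero, toRel_bdS, he, ← π_toLimit, ← hw]
    exact (congr($((limit.π (A ⋙ relChains R M Y) (a k)).comm (n + 1) n).hom w)).symm
  choose z hz using fun k => exists_push_incl (hmem k)
  have hz' : ∀ k, SRep (push R M (incl (A.obj (a k))) n (z k)) x := fun k => by
    rw [hz]
    exact hc.sub_bdS (e k)
  choose y hy using fun k =>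
    exists_sClass (n := n) (c := z k) ((hz' k).isCyc.of_push Subtype.val_injective)
  refine ⟨y, fun k => ?_, fun k => ((hy k).map _).unique (hz' k)⟩
  have hstep : e (k + 1) - e k ∈ chainsIn R M (A.obj (a k)) (n + 1) := by
    rw [← toRel_eq_zero_iff, map_sub, sub_eq_zero, he, ← toRel_map (A.map (s k)), he]
    have := limit.w (A ⋙ relChains R M Y) (s k)
    exact congrArg (fun g => (g.f (n + 1)).hom w) this
  obtain ⟨g, hg⟩ := exists_push_incl hstep
  rw [← sub_eq_zero, (((hy (k + 1)).map (stepIncl a s k)).sub (hy k)).eq_zero_iff]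
  refine ⟨-g, ?_⟩
  apply push_injective R M (g := incl (A.obj (a k))) Subtype.val_injective n
  rw [← bdS_push, map_neg, hg, map_sub, ← push_comp]
  have e1 : push R M ((incl (A.obj (a k))).comp (stepIncl a s k)) n (z (k + 1)) =
      c - bdS R M Y n (e (k + 1)) := hz (k + 1)
  rw [e1, hz, map_neg, map_sub]
  abel

/-- A homology class that comes from a compatible sequence of classes of the subspaces vanishes in
the limit of the relative chain complexes. The differences of representing cycles are boundaries of
chains in smaller and smaller subspaces, so that the sum of these chains exists in the limit. -/
lemma toLimit_eq_zero_of_seq (hcofinal : ∀ j, ∃ k, Nonempty (a k ⟶ j)) (x : H R M n Y)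
    (y : ∀ k, H R M n (A.obj (a k))) (hstep : ∀ k, Hmap R M n (stepIncl a s k) (y (k + 1)) = y k)
    (h0 : Hmap R M n (incl (A.obj (a 0))) (y 0) = x) :
    (HomologicalComplex.homologyMap (toLimit R M A) n).hom x = 0 := by
  obtain ⟨c, hc⟩ := exists_sRep x
  choose z hz using fun k => exists_sRep (y k)
  obtain ⟨e₀, he₀⟩ := ((hc.sub ((hz 0).map _)).eq_zero_iff).1 (sub_eq_zero.2 h0.symm)
  choose g hg using fun k => (((hz k).sub ((hz (k + 1)).map (stepIncl a s k))).eq_zero_iff).1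
    (sub_eq_zero.2 (hstep k).symm)
  let e : ℕ → (Sing (n + 1) Y →₀ M) := fun k =>
    e₀ + ∑ i ∈ Finset.range k, push R M (incl (A.obj (a i))) (n + 1) (g i)
  have he : ∀ k, bdS R M Y n (e k) = c - push R M (incl (A.obj (a k))) n (z k) := by
    intro k
    induction k with
    | zero =>
      simp only [e, Finset.range_zero, Finset.sum_empty, add_zero]
      exact he₀
    | succ k ih =>
      have e1 : e (k + 1) = e k + push R M (incl (A.obj (a k))) (n + 1) (g k) := by
        simp only [e, Finset.sum_range_succ, add_assoc]
      have e2 : push R M (incl (A.obj (a k))) n (push R M (stepIncl a s k) n (z (k + 1))) =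
          push R M (incl (A.obj (a (k + 1)))) n (z (k + 1)) := by
        rw [← push_comp]
        rfl
      rw [e1, map_add, ih, bdS_push, hg, map_sub, e2]
      abel
  -- The images of the chains `e k` are stationary in each relative chain complex.
  have hle : ∀ {j j' : J}, (j ⟶ j') → A.obj j ⊆ A.obj j' := fun i => leOfHom (A.map i)
  have hanti : Antitone fun k => A.obj (a k) := antitone_nat_of_succ_le fun k => hle (s k)
  have hstat : ∀ {j k}, (a k ⟶ j) → ∀ m, k ≤ m →
      toRel R M (A.obj j) (n + 1) (e m) = toRel R M (A.obj j) (n + 1) (e k) := by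
    intro j k i m hm
    induction m, hm using Nat.le_induction with
    | base => rfl
    | succ m hm ih =>
      have e1 : e (m + 1) = e m + push R M (incl (A.obj (a m))) (n + 1) (g m) := by
        simp only [e, Finset.sum_range_succ, add_assoc]
      rw [e1, map_add, ih, (toRel_eq_zero_iff _ (push R M _ _ _)).2, add_zero]
      exact chainsIn_mono ((hanti hm).trans (hle i)) _ (push_incl_mem _ _ _)
  choose κ hκ using hcofinal
  obtain ⟨w, hw, -⟩ := existsUnique_limit (A ⋙ relChains R M Y) (n + 1)
    (fun j => toRel R M (A.obj j) (n + 1) (e (κ j))) (by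
      intro j j' i
      refine (toRel_map (A.map i) _).trans ?_
      rw [← hstat (hκ j').some (max (κ j) (κ j')) (le_max_right _ _),
        ← hstat ((hκ j).some ≫ i) (max (κ j) (κ j')) (le_max_left _ _)])
  refine (Rep.map (toLimit R M A) hc).eq_zero_iff.2 ⟨w, limit_ext _ _ fun j => ?_⟩
  rw [π_toLimit]
  refine (congr($((limit.π (A ⋙ relChains R M Y) j).comm (n + 1) n).hom w)).symm.trans ?_
  refine (congrArg _ (hw j)).trans ((toRel_bdS _ _).symm.trans ?_)
  rw [he, map_sub, (toRel_eq_zero_iff _ (push R M _ n _)).2, sub_zero]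
  exact chainsIn_mono (hle (hκ j).some) _ (push_incl_mem _ _ _)

end SingChains

/-! ### Linear relations -/

namespace LinRel

variable {R : Type*} [CommRing R] {V : Type*} [AddCommGroup V] [Module R V]
  {ρ : Submodule R (V × V)}

lemma mem_dag {a b : V} : (a, b) ∈ dag ρ ↔ (b, a) ∈ ρ := Iff.rfl

lemma mem_Kplus_of_rel {v w : V} (h : (v, w) ∈ ρ) (hw : w ∈ Kplus ρ) : v ∈ Kplus ρ := by
  obtain ⟨k, s, rfl, hsk, hs⟩ := hw
  refine ⟨k + 1, fun i => Nat.casesOn i v s, rfl, hsk, fun i hi => ?_⟩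
  cases i with
  | zero => exact h
  | succ i => exact hs i (by omega)

lemma mem_Dplus_of_rel {v w : V} (h : (v, w) ∈ ρ) (hw : w ∈ Dplus ρ) : v ∈ Dplus ρ := by
  obtain ⟨s, rfl, hs⟩ := hw
  refine ⟨fun i => Nat.casesOn i v s, rfl, fun i => ?_⟩
  cases i with
  | zero => exact h
  | succ i => exact hs i

lemma exists_rel_of_mem_Dplus {v : V} (hv : v ∈ Dplus ρ) : ∃ w ∈ Dplus ρ, (v, w) ∈ ρ := by
  obtain ⟨s, rfl, hs⟩ := hv
  exact ⟨s 1, ⟨fun i => s (i + 1), rfl, fun i => hs (i + 1)⟩, hs 0⟩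

lemma exists_rel_of_mem_Dtot {v : V} (hv : v ∈ Dtot ρ) : ∃ w ∈ Dtot ρ, (v, w) ∈ ρ := by
  obtain ⟨w, hw, hvw⟩ := exists_rel_of_mem_Dplus hv.2
  exact ⟨w, ⟨mem_Dplus_of_rel (mem_dag.2 hvw) hv.1, hw⟩, hvw⟩

lemma exists_rel_to_mem_Dtot {v : V} (hv : v ∈ Dtot ρ) : ∃ w ∈ Dtot ρ, (w, v) ∈ ρ := by
  obtain ⟨w, hw, hvw⟩ := exists_rel_of_mem_Dplus hv.1
  exact ⟨w, ⟨hw, mem_Dplus_of_rel hvw hv.2⟩, hvw⟩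

variable (ρ) in
/-- The elements of `D₊` that end a chain of `k` relations in `D₊`. -/
def image : ℕ → Submodule R V
  | 0 => Dplus ρ
  | k + 1 => (ρ ⊓ (image k).comap (LinearMap.fst R V V)).map (LinearMap.snd R V V) ⊓ Dplus ρ

lemma mem_image_succ {k : ℕ} {w : V} :
    w ∈ image ρ (k + 1) ↔ (∃ v ∈ image ρ k, (v, w) ∈ ρ) ∧ w ∈ Dplus ρ := by
  simp only [image, Submodule.mem_inf, Submodule.mem_map, Submodule.mem_comap,
    LinearMap.fst_apply, LinearMap.snd_apply, Prod.exists]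
  refine and_congr_left fun _ => ⟨?_, ?_⟩
  · rintro ⟨a, b, ⟨h1, h2⟩, rfl⟩
    exact ⟨a, h2, h1⟩
  · rintro ⟨v, hv, h⟩
    exact ⟨v, w, ⟨h, hv⟩, rfl⟩

lemma image_antitone : Antitone (image ρ) := by
  refine antitone_nat_of_succ_le fun k => ?_
  induction k with
  | zero => exact inf_le_right
  | succ k ih =>
    intro w hw
    obtain ⟨⟨v, hv, h⟩, hw⟩ := mem_image_succ.1 hw
    exact mem_image_succ.2 ⟨⟨v, ih hv, h⟩, hw⟩

/-- On an Artinian module, `D₊ ⊆ D + K₊`: the images of `D₊` under the powers of the relation become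
stationary, the stationary image `W` is contained in `D`, and a long enough chain that starts at an
element of `D₊` ends in `W` and so can be corrected by a chain in `W`. -/
lemma Dplus_le_of_isArtinian [IsArtinian R V] : Dplus ρ ≤ Dtot ρ ⊔ Kplus ρ := by
  obtain ⟨N, hN⟩ := IsArtinian.monotone_stabilizes
    ⟨fun k => OrderDual.toDual (image ρ k), fun _ _ h => image_antitone h⟩
  have hN' : image ρ N = image ρ (N + 1) := hN (N + 1) (Nat.le_succ N)
  have hpred : ∀ w ∈ image ρ N, ∃ v ∈ image ρ N, (v, w) ∈ ρ := by
    intro w hw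
    rw [hN'] at hw
    exact (mem_image_succ.1 hw).1
  have hD : image ρ N ≤ Dtot ρ := by
    intro w hw
    refine ⟨?_, image_antitone (Nat.zero_le N) hw⟩
    choose! p hp hpρ using hpred
    have hmem : ∀ i : ℕ, p^[i] w ∈ image ρ N := by
      intro i
      induction i with
      | zero => exact hw
      | succ i ih => rw [Function.iterate_succ_apply']; exact hp _ ih
    refine ⟨fun i => p^[i] w, rfl, fun i => ?_⟩
    change (p^[i] w, p^[i + 1] w) ∈ dag ρ
    rw [Function.iterate_succ_apply']
    exact mem_dag.2 (hpρ _ (hmem i))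
  -- A chain of length `m` from `v` to `W` differs from a chain in `W` by a chain that ends in `0`.
  have hcorr : ∀ (m : ℕ) (s : ℕ → V), (∀ i, (s i, s (i + 1)) ∈ ρ) → s m ∈ image ρ N →
      s 0 ∈ image ρ N ⊔ Kplus ρ := by
    intro m s hs hm
    have key : ∀ j ≤ m, ∃ w ∈ image ρ N, s (m - j) - w ∈ Kplus ρ := by
      intro j
      induction j with
      | zero => exact fun _ => ⟨s m, hm, by simp⟩
      | succ j ih =>
        intro hj
        obtain ⟨w, hw, hsw⟩ := ih (by omega)
        obtain ⟨w', hw', hww⟩ := hpred w hw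
        refine ⟨w', hw', mem_Kplus_of_rel ?_ hsw⟩
        have := ρ.sub_mem (hs (m - (j + 1))) hww
        rwa [show m - (j + 1) + 1 = m - j by omega] at this
    obtain ⟨w, hw, h⟩ := key m le_rfl
    rw [Nat.sub_self] at h
    exact Submodule.mem_sup.2 ⟨w, hw, _, h, add_sub_cancel _ _⟩
  rintro v ⟨s, rfl, hs⟩
  have hs' : ∀ k, s k ∈ image ρ k := by
    intro k
    have hDk : s k ∈ Dplus ρ := ⟨fun i => s (k + i), rfl, fun i => hs (k + i)⟩
    induction k with
    | zero => exact hDk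
    | succ k ih =>
      exact mem_image_succ.2 ⟨⟨s k, ih ⟨fun i => s (k + i), rfl, fun i => hs (k + i)⟩, hs k⟩, hDk⟩
  exact sup_le_sup_right hD _ (hcorr N s hs (hs' N))

end LinRel

/-! ### Spaces that are cut into slabs -/

namespace NovikovHomology

open SingChains LinRel

variable (R : Type v) [CommRing R] (M : Type u) [AddCommGroup M] [Module R M] (n : ℕ)
  (Y F : Type u) [TopologicalSpace Y] [TopologicalSpace F]

/-- A continuous map with values in a subspace. -/
def corestr {Y F : Type u} [TopologicalSpace Y] [TopologicalSpace F] (g : C(F, Y)) {A : Set Y}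
    (h : ∀ x, g x ∈ A) : C(F, A) :=
  ⟨fun x => ⟨g x, h x⟩, by fun_prop⟩

/-- A space `Y` that is cut by copies of `F`, indexed by the integers, into slabs, together with
the homological properties of the subspaces above and below the copies of `F` on which the
computation of the kernels of the maps to Novikov homology depends: the Mayer–Vietoris property for
cutting along a copy of `F`, compactness of supports, and a relation `ρ` on the homology of `F` that
describes each slab. The data can be turned upside down, see `SlabSystem.dual`. The intersections of
pieces are given by a variable `S` and an equation, since `-(-k)` and `k + 1` agree with other forms
of an index only propositionally. -/
structure SlabSystem where
  /-- The part of `Y` above the `k`-th copy of `F`. -/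
  up : ℤ → Set Y
  /-- The part of `Y` below the `k`-th copy of `F`. -/
  dn : ℤ → Set Y
  /-- The `k`-th copy of `F`. -/
  lvl : ℤ → C(F, Y)
  /-- The relation on the homology of `F`. -/
  rel : Submodule R (H R M n F × H R M n F)
  up_anti : Antitone up
  dn_mono : Monotone dn
  cover : ∀ k, dn k ∪ up k = Set.univ
  lvl_up : ∀ k x, lvl k x ∈ up k
  lvl_dn : ∀ k x, lvl k x ∈ dn k
  /-- The Mayer–Vietoris property of pieces `A` and `B` of `Y` below and above the `k`-th copy
  of `F`. -/
  exists_of_eq : ∀ (k : ℤ) (A B C : Set Y) (hAC : A ⊆ C) (hBC : B ⊆ C), C ⊆ A ∪ B →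
    A ⊆ dn k → B ⊆ up k → ∀ (hFA : ∀ x, lvl k x ∈ A) (hFB : ∀ x, lvl k x ∈ B),
    up (k - 1) ∩ dn (k + 1) ⊆ C → ∀ (a : H R M n A) (b : H R M n B),
    Hmap R M n (inclSub hAC) a = Hmap R M n (inclSub hBC) b →
    ∃ w : H R M n F, Hmap R M n (corestr (lvl k) hFA) w = a ∧
      Hmap R M n (corestr (lvl k) hFB) w = b
  /-- Two classes are related if and only if they agree in the slab between two successive copies
  of `F`. -/
  mem_rel_iff : ∀ (k l : ℤ) (S : Set Y), l = k + 1 → S = up k ∩ dn l →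
    ∀ (hk : ∀ x, lvl k x ∈ S) (hl : ∀ x, lvl l x ∈ S) (a b : H R M n F),
    (a, b) ∈ rel ↔ Hmap R M n (corestr (lvl k) hk) a = Hmap R M n (corestr (lvl l) hl) b
  /-- A class that vanishes above a copy of `F` vanishes in finitely many slabs above it. -/
  compact_up : ∀ (k : ℤ) (w : H R M n F), Hmap R M n (corestr (lvl k) (lvl_up k)) w = 0 →
    ∃ l > k, ∀ (S : Set Y), S = up k ∩ dn l → ∀ hk : ∀ x, lvl k x ∈ S,
      Hmap R M n (corestr (lvl k) hk) w = 0
  /-- A class that vanishes below a copy of `F` vanishes in finitely many slabs below it. -/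
  compact_dn : ∀ (k : ℤ) (w : H R M n F), Hmap R M n (corestr (lvl k) (lvl_dn k)) w = 0 →
    ∃ l < k, ∀ (S : Set Y), S = up l ∩ dn k → ∀ hk : ∀ x, lvl k x ∈ S,
      Hmap R M n (corestr (lvl k) hk) w = 0
  exhaust_dn : ∀ x : H R M n Y, ∃ K : ℕ, ∀ k ≥ (K : ℤ), ∃ z : H R M n (dn k),
    Hmap R M n (incl (dn k)) z = x
  exhaust_up : ∀ x : H R M n Y, ∃ K : ℕ, ∀ k ≤ -(K : ℤ), ∃ z : H R M n (up k),
    Hmap R M n (incl (up k)) z = x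

namespace SlabSystem

variable {R M n Y F} (L : SlabSystem R M n Y F)

/-- The same slabs, upside down. -/
def dual : SlabSystem R M n Y F where
  up k := L.dn (-k)
  dn k := L.up (-k)
  lvl k := L.lvl (-k)
  rel := dag L.rel
  up_anti _ _ h := L.dn_mono (neg_le_neg h)
  dn_mono _ _ h := L.up_anti (neg_le_neg h)
  cover k := (Set.union_comm _ _).trans (L.cover (-k))
  lvl_up k := L.lvl_dn (-k)
  lvl_dn k := L.lvl_up (-k)
  exists_of_eq k A B C hAC hBC hC hA hB hFA hFB hk a b hab := by
    obtain ⟨w, h1, h2⟩ := L.exists_of_eq (-k) B A C hBC hAC (Set.union_comm A B ▸ hC) hB hA hFB hFA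
      (by
        rw [show -k - 1 = -(k + 1) by ring, show -k + 1 = -(k - 1) by ring, Set.inter_comm]
        exact hk) b a hab.symm
    exact ⟨w, h2, h1⟩
  mem_rel_iff k l S hl hS hk hl' a b := by
    rw [mem_dag, L.mem_rel_iff (-l) (-k) S (by omega) (hS.trans (Set.inter_comm _ _)) hl' hk]
    exact eq_comm
  compact_up k w hw := by
    obtain ⟨l, hl, h⟩ := L.compact_dn (-k) w hw
    exact ⟨-l, by omega, fun S hS => h S (by rw [hS, neg_neg, Set.inter_comm])⟩
  compact_dn k w hw := by
    obtain ⟨l, hl, h⟩ := L.compact_up (-k) w hw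
    exact ⟨-l, by omega, fun S hS => h S (by rw [hS, neg_neg, Set.inter_comm])⟩
  exhaust_dn x := by
    obtain ⟨K, h⟩ := L.exhaust_up x
    exact ⟨K, fun k hk => h (-k) (by omega)⟩
  exhaust_up x := by
    obtain ⟨K, h⟩ := L.exhaust_dn x
    exact ⟨K, fun k hk => h (-k) (by omega)⟩

/-- The map from the homology of the `k`-th copy of `F` to the homology of `Y`. -/
abbrev ι (k : ℤ) : H R M n F →ₗ[R] H R M n Y := Hmap R M n (L.lvl k)

lemma exists_of_incl_eq (k : ℤ) (a : H R M n (L.dn k)) (b : H R M n (L.up k))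
    (hab : Hmap R M n (incl (L.dn k)) a = Hmap R M n (incl (L.up k)) b) :
    ∃ w : H R M n F, Hmap R M n (corestr (L.lvl k) (L.lvl_dn k)) w = a ∧
      Hmap R M n (corestr (L.lvl k) (L.lvl_up k)) w = b := by
  refine L.exists_of_eq k (L.dn k) (L.up k) Set.univ (Set.subset_univ _) (Set.subset_univ _)
    (L.cover k).ge subset_rfl subset_rfl _ _ (Set.subset_univ _) a b ?_
  have hinj : Function.Injective (Hmap R M n (incl (Set.univ : Set Y))) :=
    (Hmap_bijective_of_inverse (k := corestr (.id Y) fun _ => Set.mem_univ _) rfl rfl).1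
  apply hinj
  rw [← Hmap_comp_apply, ← Hmap_comp_apply]
  exact hab

/-- Related classes agree in the space above. -/
lemma eq_up_of_rel {k l : ℤ} (hl : l = k + 1) {a b : H R M n F} (hab : (a, b) ∈ L.rel) :
    Hmap R M n (corestr (L.lvl k) (L.lvl_up k)) a =
      Hmap R M n (inclSub (L.up_anti (by omega : k ≤ l)))
        (Hmap R M n (corestr (L.lvl l) (L.lvl_up l)) b) := by
  have h := (L.mem_rel_iff k l _ hl rfl
    (fun x => ⟨L.lvl_up k x, L.dn_mono (by omega) (L.lvl_dn k x)⟩)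
    (fun x => ⟨L.up_anti (by omega) (L.lvl_up l x), L.lvl_dn l x⟩) a b).1 hab
  have h' := congrArg (Hmap R M n (inclSub (Set.inter_subset_left (s := L.up k)))) h
  rw [← Hmap_comp_apply, ← Hmap_comp_apply] at h'
  rw [← Hmap_comp_apply]
  exact h'

lemma ι_eq_of_rel {k l : ℤ} (hl : l = k + 1) {a b : H R M n F} (hab : (a, b) ∈ L.rel) :
    L.ι k a = L.ι l b := by
  have h := congrArg (Hmap R M n (incl (L.up k))) (L.eq_up_of_rel hl hab)
  rw [← Hmap_comp_apply, ← Hmap_comp_apply, ← Hmap_comp_apply] at h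
  exact h

lemma ι_eq_zero_of_mem_Kplus (k : ℤ) {v : H R M n F} (hv : v ∈ Kplus L.rel) : L.ι k v = 0 := by
  obtain ⟨m, s, rfl, hsm, hs⟩ := hv
  have : ∀ i : ℕ, i ≤ m + 1 → L.ι k (s 0) = L.ι (k + i) (s i) := by
    intro i
    induction i with
    | zero => simp
    | succ i ih =>
      intro hi
      rw [ih (by omega)]
      exact L.ι_eq_of_rel (by push_cast; ring) (hs i (by omega))
  rw [this (m + 1) le_rfl, hsm, map_zero]

/-- A class of the `k`-th copy of `F` that vanishes in finitely many slabs above it belongs to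
`K₊`, by cutting along the next copy of `F`. -/
lemma mem_Kplus_of_slab_eq_zero (m : ℕ) (k l : ℤ) (hl : l = k + m + 1) (v : H R M n F)
    (hk : ∀ x, L.lvl k x ∈ L.up k ∩ L.dn l) (hv : Hmap R M n (corestr (L.lvl k) hk) v = 0) :
    v ∈ Kplus L.rel := by
  induction m generalizing k v with
  | zero =>
    refine mem_Kplus_of_rel ((L.mem_rel_iff k l _ (by omega) rfl hk
      (fun x => ⟨L.up_anti (by omega) (L.lvl_up l x), L.lvl_dn l x⟩) v 0).2 ?_)
      (Kplus L.rel).zero_mem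
    rw [hv, map_zero]
  | succ m ih =>
    have hkA : ∀ x, L.lvl k x ∈ L.up k ∩ L.dn (k + 1) := fun x =>
      ⟨L.lvl_up k x, L.dn_mono (by omega) (L.lvl_dn k x)⟩
    have hFA : ∀ x, L.lvl (k + 1) x ∈ L.up k ∩ L.dn (k + 1) := fun x =>
      ⟨L.up_anti (by omega) (L.lvl_up (k + 1) x), L.lvl_dn (k + 1) x⟩
    have hFB : ∀ x, L.lvl (k + 1) x ∈ L.up (k + 1) ∩ L.dn l := fun x =>
      ⟨L.lvl_up (k + 1) x, L.dn_mono (by omega) (L.lvl_dn (k + 1) x)⟩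
    obtain ⟨w, h1, h2⟩ := L.exists_of_eq (k + 1) (L.up k ∩ L.dn (k + 1)) (L.up (k + 1) ∩ L.dn l)
      (L.up k ∩ L.dn l)
      (Set.inter_subset_inter_right _ (L.dn_mono (by omega)))
      (Set.inter_subset_inter_left _ (L.up_anti (by omega)))
      (fun y hy => by
        rcases (L.cover (k + 1)).ge (Set.mem_univ y) with h | h
        · exact .inl ⟨hy.1, h⟩
        · exact .inr ⟨h, hy.2⟩)
      Set.inter_subset_right Set.inter_subset_left hFA hFB
      (Set.inter_subset_inter (L.up_anti (by omega)) (L.dn_mono (by omega)))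
      (Hmap R M n (corestr (L.lvl k) hkA) v) 0
      (by
        rw [map_zero, ← Hmap_comp_apply]
        exact hv)
    exact mem_Kplus_of_rel ((L.mem_rel_iff k (k + 1) _ rfl rfl hkA hFA v w).2 h1.symm)
      (ih (k + 1) (by push_cast at hl; omega) w hFB h2)

lemma mem_Kplus_of_up_eq_zero (k : ℤ) (v : H R M n F)
    (hv : Hmap R M n (corestr (L.lvl k) (L.lvl_up k)) v = 0) : v ∈ Kplus L.rel := by
  obtain ⟨l, hl, h⟩ := L.compact_up k v hv
  exact L.mem_Kplus_of_slab_eq_zero (l - k - 1).toNat k l (by omega) v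
    (fun x => ⟨L.lvl_up k x, L.dn_mono hl.le (L.lvl_dn k x)⟩) (h _ rfl _)

/-- The classes that come from a compatible sequence of classes of the subspaces `up k`. -/
def IsUpLimit (x : H R M n Y) : Prop :=
  ∃ y : ∀ k : ℕ, H R M n (L.up k),
    (∀ k : ℕ, Hmap R M n (inclSub (L.up_anti (by omega : (k : ℤ) ≤ (k + 1 : ℕ)))) (y (k + 1)) =
      y k) ∧ ∀ k : ℕ, Hmap R M n (incl (L.up k)) (y k) = x

lemma isUpLimit_of_mem_Dplus {v : H R M n F} (hv : v ∈ Dplus L.rel) : L.IsUpLimit (L.ι 0 v) := by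
  obtain ⟨s, rfl, hs⟩ := hv
  have hstep : ∀ k : ℕ, Hmap R M n (inclSub (L.up_anti (by omega : (k : ℤ) ≤ (k + 1 : ℕ))))
      (Hmap R M n (corestr (L.lvl (k + 1 : ℕ)) (L.lvl_up _)) (s (k + 1))) =
      Hmap R M n (corestr (L.lvl k) (L.lvl_up _)) (s k) := fun k =>
    (L.eq_up_of_rel (by push_cast; ring) (hs k)).symm
  refine ⟨fun k => Hmap R M n (corestr (L.lvl k) (L.lvl_up _)) (s k), hstep, fun k => ?_⟩
  induction k with
  | zero =>
    rw [← Hmap_comp_apply]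
    rfl
  | succ k ih =>
    refine Eq.trans ?_ ((congrArg (Hmap R M n (incl (L.up k))) (hstep k)).trans ih)
    rw [← Hmap_comp_apply (inclSub _)]
    rfl

/-- A class of a copy of `F` that is part of a compatible sequence belongs to `D₊`. -/
lemma mem_Dplus_of_seq (y : ∀ k : ℕ, H R M n (L.up k))
    (hy : ∀ k : ℕ, Hmap R M n (inclSub (L.up_anti (by omega : (k : ℤ) ≤ (k + 1 : ℕ)))) (y (k + 1)) =
      y k) (K : ℕ) (v : H R M n F) (hv : Hmap R M n (corestr (L.lvl K) (L.lvl_up K)) v = y K) :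
    v ∈ Dplus L.rel := by
  have step : ∀ (k : ℕ) (v : H R M n F), Hmap R M n (corestr (L.lvl k) (L.lvl_up k)) v = y k →
      ∃ w, Hmap R M n (corestr (L.lvl (k + 1 : ℕ)) (L.lvl_up _)) w = y (k + 1) ∧
        (v, w) ∈ L.rel := by
    intro k v hv
    have hl : ((k + 1 : ℕ) : ℤ) = k + 1 := by push_cast; ring
    set l : ℤ := ((k + 1 : ℕ) : ℤ) with hldef
    have hkA : ∀ x, L.lvl k x ∈ L.up k ∩ L.dn l := fun x =>
      ⟨L.lvl_up k x, L.dn_mono (by omega) (L.lvl_dn k x)⟩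
    have hFA : ∀ x, L.lvl l x ∈ L.up k ∩ L.dn l := fun x =>
      ⟨L.up_anti (by omega) (L.lvl_up l x), L.lvl_dn l x⟩
    obtain ⟨w, h1, h2⟩ := L.exists_of_eq l (L.up k ∩ L.dn l) (L.up l) (L.up k)
      Set.inter_subset_left (L.up_anti (by omega))
      (fun z hz => by
        rcases (L.cover l).ge (Set.mem_univ z) with h | h
        · exact .inl ⟨hz, h⟩
        · exact .inr h)
      Set.inter_subset_right subset_rfl hFA (L.lvl_up l)
      (Set.inter_subset_left.trans (L.up_anti (by omega)))
      (Hmap R M n (corestr (L.lvl k) hkA) v) (y (k + 1))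
      (by
        rw [hy, ← hv, ← Hmap_comp_apply]
        rfl)
    exact ⟨w, h2, (L.mem_rel_iff k l _ hl rfl hkA hFA v w).2 h1.symm⟩
  choose f hf hfρ using step
  let s : ∀ i : ℕ, {v : H R M n F //
      Hmap R M n (corestr (L.lvl (K + i : ℕ)) (L.lvl_up _)) v = y (K + i)} := fun i =>
    Nat.rec ⟨v, hv⟩ (fun i v => ⟨f (K + i) v.1 v.2, hf (K + i) v.1 v.2⟩) i
  exact ⟨fun i => (s i).1, rfl, fun i => hfρ (K + i) (s i).1 (s i).2⟩

/-- The inclusion of a copy of `F` kills exactly the part `K₋ + K₊` of its homology. -/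
lemma ι_eq_zero_iff (v : H R M n F) : L.ι 0 v = 0 ↔ v ∈ Kminus L.rel ⊔ Kplus L.rel := by
  constructor
  · intro hv
    obtain ⟨w, h1, h2⟩ := L.exists_of_incl_eq 0
      (Hmap R M n (corestr (L.lvl 0) (L.lvl_dn 0)) v) 0 (by
        rw [map_zero, ← Hmap_comp_apply]
        exact hv)
    refine Submodule.mem_sup.2 ⟨v - w, ?_, w, L.mem_Kplus_of_up_eq_zero 0 w h2,
      sub_add_cancel v w⟩
    refine L.dual.mem_Kplus_of_up_eq_zero 0 (v - w) ?_
    rw [map_sub, sub_eq_zero]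
    exact h1.symm
  · intro hv
    obtain ⟨a, ha, b, hb, rfl⟩ := Submodule.mem_sup.1 hv
    rw [map_add, L.ι_eq_zero_of_mem_Kplus 0 hb, add_zero]
    exact L.dual.ι_eq_zero_of_mem_Kplus 0 ha

/-- The classes that come from both ends of `Y` are the images of the elements of `D`. -/
lemma isUpLimit_and_iff (x : H R M n Y) :
    L.dual.IsUpLimit x ∧ L.IsUpLimit x ↔ ∃ v ∈ Dtot L.rel, L.ι 0 v = x := by
  constructor
  · rintro ⟨⟨y, hy, hyx⟩, ⟨z, hz, hzx⟩⟩
    obtain ⟨w, h1, h2⟩ := L.exists_of_incl_eq 0 (y 0) (z 0) ((hyx 0).trans (hzx 0).symm)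
    refine ⟨w, ⟨L.dual.mem_Dplus_of_seq y hy 0 w h1, L.mem_Dplus_of_seq z hz 0 w h2⟩, ?_⟩
    rw [← hzx 0, ← h2, ← Hmap_comp_apply]
    rfl
  · rintro ⟨v, hv, rfl⟩
    exact ⟨L.dual.isUpLimit_of_mem_Dplus hv.1, L.isUpLimit_of_mem_Dplus hv.2⟩

lemma exists_mem_Dplus_of_isUpLimit {x : H R M n Y} (hx : L.IsUpLimit x) :
    ∃ (K : ℕ), ∃ v ∈ Dplus L.rel, L.ι K v = x := by
  obtain ⟨y, hy, hyx⟩ := hx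
  obtain ⟨K, hK⟩ := L.exhaust_dn x
  obtain ⟨z, hz⟩ := hK K le_rfl
  obtain ⟨w, h1, h2⟩ := L.exists_of_incl_eq K z (y K) (hz.trans (hyx K).symm)
  refine ⟨K, w, L.mem_Dplus_of_seq y hy K w h2, ?_⟩
  rw [← hyx K, ← h2, ← Hmap_comp_apply]
  rfl

/-- If the homology of `F` is Artinian, then the classes that come from the upper end of `Y` also
come from the lower end. -/
lemma exists_mem_Dtot_of_isUpLimit [IsArtinian R (H R M n F)] {x : H R M n Y}
    (hx : L.IsUpLimit x) : ∃ v ∈ Dtot L.rel, L.ι 0 v = x := by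
  obtain ⟨K, v, hv, rfl⟩ := L.exists_mem_Dplus_of_isUpLimit hx
  obtain ⟨d, hd, w, hw, rfl⟩ := Submodule.mem_sup.1 (Dplus_le_of_isArtinian hv)
  have hshift : ∀ (k : ℕ), ∀ d ∈ Dtot L.rel, ∃ v ∈ Dtot L.rel, L.ι 0 v = L.ι k d := by
    intro k
    induction k with
    | zero => exact fun d hd => ⟨d, hd, rfl⟩
    | succ k ih =>
      intro d hd
      obtain ⟨d', hd', h⟩ := exists_rel_to_mem_Dtot hd
      rw [← L.ι_eq_of_rel (k := k) (by push_cast; ring) h]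
      exact ih d' hd'
  rw [map_add, L.ι_eq_zero_of_mem_Kplus K hw, add_zero]
  exact hshift K d hd

end SlabSystem

end NovikovHomology

/-! ### Cutting the infinite cyclic covering along fibers -/

namespace AngleValued

open NovikovHomology SingChains LinRel

variable {X : Type u} [TopologicalSpace X] {f : C(X, Circle)} {θ : Circle}

lemma continuous_lift : Continuous (lift f) := continuous_snd.comp continuous_subtype_val

/-- A tame value has a deformation on an open neighborhood of the fiber that stays over the
complement of the antipode of the value. -/
lemma IsTameValue.exists_open (hθ : IsTameValue f θ) :
    ∃ (V : Set X) (h : C(V × unitInterval, X)), IsOpen V ∧ f ⁻¹' {θ} ⊆ V ∧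
      (∀ x : V, h (x, 0) = x) ∧ (∀ x : V, h (x, 1) ∈ f ⁻¹' {θ}) ∧
      (∀ (x : V) (τ : unitInterval), (x : X) ∈ f ⁻¹' {θ} → h (x, τ) = x) ∧
      ∀ p, (f (h p) / θ : Circle) ∈ {z : Circle | (z : ℂ) ∈ Complex.slitPlane} := by
  obtain ⟨U, h, hU, h0, h1, hfix⟩ := hθ
  have hW : IsOpen {z : Circle | (z : ℂ) ∈ Complex.slitPlane} :=
    Complex.isOpen_slitPlane.preimage (by fun_prop)
  let h' : C(interior U × unitInterval, X) :=
    h.comp ((inclSub interior_subset).prodMap (.id _))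
  let W : Set (interior U × unitInterval) :=
    {p | (f (h' p) / θ : Circle) ∈ {z : Circle | (z : ℂ) ∈ Complex.slitPlane}}
  have hWo : IsOpen W := hW.preimage (by fun_prop)
  let V : Set X := Subtype.val '' {x : interior U | ∀ τ, (x, τ) ∈ W}
  have hVU : V ⊆ interior U := by
    rintro _ ⟨x, -, rfl⟩
    exact x.2
  refine ⟨V, h'.comp ((inclSub hVU).prodMap (.id _)),
    isOpen_interior.isOpenMap_subtype_val _ (isOpen_setOf_forall_mem hWo), ?_,
    fun x => h0 _, fun x => h1 _, fun x τ hx => hfix _ _ hx, ?_⟩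
  · intro x hx
    have hxU : x ∈ interior U := subset_interior_iff_mem_nhdsSet.2 hU hx
    refine ⟨⟨x, hxU⟩, fun τ => ?_, rfl⟩
    have e : h' (⟨x, hxU⟩, τ) = x := hfix _ _ hx
    change (f (h' (⟨x, hxU⟩, τ)) / θ : Circle) ∈ {z : Circle | (z : ℂ) ∈ Complex.slitPlane}
    rw [e, show f x = θ from hx, div_self']
    simp
  · rintro ⟨⟨_, y, hy, rfl⟩, τ⟩
    exact hy τ

variable {R : Type v} [CommRing R] {M : Type u} [AddCommGroup M] [Module R M] {n : ℕ}

/-- The copy of the fiber over `θ` in the covering at the height `c`. -/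
abbrev fiberAt {c : ℝ} (hc : Circle.exp c = θ) : C(Fiber f θ, Cover f) := inclCover hc

lemma arg_div_of_lift {c : ℝ} (hc : Circle.exp c = θ) (y : Cover f)
    (hy : |lift f y - c| < Real.pi) : c + Complex.arg (f y.1.1 / θ : Circle) = lift f y := by
  have e : (f y.1.1 / θ : Circle) = Circle.exp (lift f y - c) := by
    rw [Circle.exp_sub, hc, y.2]
    rfl
  obtain ⟨h1, h2⟩ := abs_lt.1 hy
  rw [e, Circle.arg_exp (by linarith) h2.le]
  ring

/-- The Mayer–Vietoris property for cutting a subspace of the covering along a copy of the fiber over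
a tame value. The deformation of a neighborhood of the fiber in `X` is lifted to the covering by means
of the argument function. -/
lemma exists_of_fiber (hθ : IsTameValue f θ) {c : ℝ} (hc : Circle.exp c = θ) {A B C : Set (Cover f)}
    (hAC : A ⊆ C) (hBC : B ⊆ C) (hC : C ⊆ A ∪ B) (hA : A ⊆ lift f ⁻¹' Set.Iic c)
    (hB : B ⊆ lift f ⁻¹' Set.Ici c) (hFA : ∀ x, fiberAt hc x ∈ A) (hFB : ∀ x, fiberAt hc x ∈ B)
    (hCc : ∀ y : Cover f, |lift f y - c| < Real.pi → y ∈ C)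
    (a : H R M n A) (b : H R M n B)
    (hab : Hmap R M n (inclSub hAC) a = Hmap R M n (inclSub hBC) b) :
    ∃ w : H R M n (Fiber f θ), Hmap R M n (corestr (fiberAt hc) hFA) w = a ∧
      Hmap R M n (corestr (fiberAt hc) hFB) w = b := by
  obtain ⟨V, h, hV, hFV, h0, h1, hfix, hslit⟩ := hθ.exists_open
  have hexp : ∀ y : Cover f, lift f y = c → f y.1.1 = θ := fun y hy => by
    rw [y.2, ← hc, ← hy]
    rfl
  have hlvl : ∀ y : Cover f, lift f y = c → y ∈ A ∧ y ∈ B := by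
    intro y hy
    have e : fiberAt hc ⟨y.1.1, hexp y hy⟩ = y := Subtype.ext (Prod.ext rfl hy.symm)
    exact ⟨e ▸ hFA _, e ▸ hFB _⟩
  have hA' : ∀ y : C, (y : Cover f) ∈ A ↔ lift f y ≤ c := fun y => ⟨fun hy => hA hy, fun hy => by
    rcases hC y.2 with h | h
    · exact h
    · exact (hlvl y (le_antisymm hy (hB h))).1⟩
  have hB' : ∀ y : C, (y : Cover f) ∈ B ↔ c ≤ lift f y := fun y => ⟨fun hy => hB hy, fun hy => by
    rcases hC y.2 with h | h
    · exact (hlvl y (le_antisymm (hA h) hy)).2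
    · exact h⟩
  let A' : Set C := {y | (y : Cover f) ∈ A}
  let B' : Set C := {y | (y : Cover f) ∈ B}
  let L' : Set C := {y | lift f y = c}
  have hcontC : Continuous fun y : C => lift f y := continuous_lift.comp continuous_subtype_val
  have hA'c : IsClosed A' := by
    have : A' = {y : C | lift f y ≤ c} := Set.ext hA'
    rw [this]
    exact isClosed_le hcontC continuous_const
  have hB'c : IsClosed B' := by
    have : B' = {y : C | c ≤ lift f y} := Set.ext hB'
    rw [this]
    exact isClosed_le continuous_const hcontC
  have hcov : A' ∪ B' = Set.univ := Set.eq_univ_of_forall fun y => hC y.2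
  have hL' : L' = A' ∩ B' := Set.ext fun y => by
    change lift f y = c ↔ (y : Cover f) ∈ A ∧ (y : Cover f) ∈ B
    rw [hA', hB']
    exact le_antisymm_iff
  let U' : Set C := {y | y.1.1.1 ∈ V ∧ |lift f y - c| < Real.pi}
  have hpr : Continuous fun y : C => y.1.1.1 := by fun_prop
  have hU' : IsOpen U' := (hV.preimage hpr).inter
    (isOpen_lt (hcontC.sub continuous_const).abs continuous_const)
  have hLU : L' ⊆ U' := fun y (hy : lift f y = c) => ⟨hFV (hexp y hy), by
    rw [hy, sub_self, abs_zero]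
    exact Real.pi_pos⟩
  let q : C(U', V) := ⟨fun y => ⟨y.1.1.1.1, y.2.1⟩, by fun_prop⟩
  let g : C(U' × unitInterval, X) := h.comp (q.prodMap (.id _))
  have hg : ∀ p, (f (g p) / θ : Circle) ∈ {z : Circle | (z : ℂ) ∈ Complex.slitPlane} :=
    fun p => hslit _
  let ψ : U' × unitInterval → ℝ := fun p => c + Complex.arg (f (g p) / θ : Circle)
  have hψ : Continuous ψ := by
    refine continuous_const.add (continuous_iff_continuousAt.2 fun p => ?_)
    refine ContinuousAt.comp (g := Complex.arg) (Complex.continuousAt_arg (hg p)) ?_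
    fun_prop
  have hψexp : ∀ p, f (g p) = Circle.exp (ψ p) := fun p => by
    rw [Circle.exp_add, hc, Circle.exp_arg, mul_div_cancel]
  have hψC : ∀ p, |ψ p - c| < Real.pi := fun p => by
    simp only [ψ, add_sub_cancel_left]
    exact abs_lt.2 ⟨Complex.neg_pi_lt_arg _, lt_of_le_of_ne (Complex.arg_le_pi _)
      (Complex.mem_slitPlane_iff_arg.1 (hg p)).1⟩
  let h' : C(U' × unitInterval, C) :=
    ⟨fun p => ⟨⟨(g p, ψ p), hψexp p⟩, hCc _ (hψC p)⟩, by fun_prop⟩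
  have key : ∀ (x : U') (τ : unitInterval), g (x, τ) = x.1.1.1.1 → h' (x, τ) = x := by
    intro x τ hx
    refine Subtype.ext (Subtype.ext (Prod.ext hx ?_))
    change c + Complex.arg (f (g (x, τ)) / θ : Circle) = lift f x.1.1
    rw [hx]
    exact arg_div_of_lift hc x.1.1 x.2.2
  have h0' : ∀ x : U', h' (x, 0) = x := fun x => key x 0 (h0 _)
  have h1' : ∀ x : U', h' (x, 1) ∈ L' := fun x => by
    have e : f (g (x, 1)) = θ := h1 _
    change c + Complex.arg (f (g (x, 1)) / θ : Circle) = c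
    rw [e, div_self']
    simp
  have hfix' : ∀ (x : U') (τ : unitInterval), (x : C) ∈ L' → h' (x, τ) = x :=
    fun x τ hx => key x τ (hfix _ _ (hexp _ hx))
  have hLA' : L' ⊆ A' := hL' ▸ Set.inter_subset_left
  have hLB' : L' ⊆ B' := hL' ▸ Set.inter_subset_right
  let iA : C(A, A') := ⟨fun y => ⟨⟨y.1, hAC y.2⟩, y.2⟩, by fun_prop⟩
  let iB : C(B, B') := ⟨fun y => ⟨⟨y.1, hBC y.2⟩, y.2⟩, by fun_prop⟩
  let rA : C(A', A) := ⟨fun y => ⟨y.1.1, y.2⟩, by fun_prop⟩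
  let rB : C(B', B) := ⟨fun y => ⟨y.1.1, y.2⟩, by fun_prop⟩
  let pL : C(L', Fiber f θ) := ⟨fun y => ⟨y.1.1.1.1, hexp _ y.2⟩, by fun_prop⟩
  obtain ⟨w, hwa, hwb⟩ := exists_of_isClosed_cover hA'c hB'c hcov hL' hLU h' h0' h1' hfix' hU'
    hLA' hLB' (Hmap R M n iA a) (Hmap R M n iB b) (by
      rw [← Hmap_comp_apply, ← Hmap_comp_apply]
      exact hab)
  have eA : (corestr (fiberAt hc) hFA).comp pL = rA.comp (inclSub hLA') := by
    refine ContinuousMap.ext fun y => ?_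
    exact Subtype.ext (Subtype.ext (Prod.ext rfl (Eq.symm y.2)))
  have eB : (corestr (fiberAt hc) hFB).comp pL = rB.comp (inclSub hLB') := by
    refine ContinuousMap.ext fun y => ?_
    exact Subtype.ext (Subtype.ext (Prod.ext rfl (Eq.symm y.2)))
  refine ⟨Hmap R M n pL w, ?_, ?_⟩
  · rw [← Hmap_comp_apply, eA, Hmap_comp_apply, hwa, ← Hmap_comp_apply]
    exact Hmap_id_apply a
  · rw [← Hmap_comp_apply, eB, Hmap_comp_apply, hwb, ← Hmap_comp_apply]
    exact Hmap_id_apply b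

end AngleValued

/-! ### The infinite cyclic covering as a system of slabs -/

namespace AngleValued

open NovikovHomology SingChains LinRel

section Heights

variable {X : Type u} [TopologicalSpace X] (f : C(X, Circle)) (t : ℝ)

/-- The heights of the lifts of an angle. -/
def height (k : ℤ) : ℝ := t + 2 * Real.pi * k

lemma height_succ (k : ℤ) : height t (k + 1) = height t k + 2 * Real.pi := by
  simp only [height]
  push_cast
  ring

lemma height_mono : Monotone (height t) := fun k l h => by
  have : (k : ℝ) ≤ l := by exact_mod_cast h
  have := mul_le_mul_of_nonneg_left this Real.two_pi_pos.le
  simp only [height]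
  linarith

lemma add_le_height (m : ℤ) (j : ℕ) : height t m + j ≤ height t (m + j) := by
  simp only [height]
  push_cast
  nlinarith [Real.pi_gt_three, (Nat.cast_nonneg j : (0 : ℝ) ≤ j)]

lemma height_le_sub (m : ℤ) (j : ℕ) : height t (m - j) ≤ height t m - j := by
  simp only [height]
  push_cast
  nlinarith [Real.pi_gt_three, (Nat.cast_nonneg j : (0 : ℝ) ≤ j)]

variable {t} in
lemma exp_height {θ : Circle} (ht : Circle.exp t = θ) (k : ℤ) : Circle.exp (height t k) = θ := by
  rw [height, Circle.exp_add, ht, Circle.exp_two_pi_mul_int, mul_one]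

/-- The part of the covering above the `k`-th lift of the fiber. -/
def upper (k : ℤ) : Set (Cover f) := lift f ⁻¹' Set.Ici (height t k)

/-- The part of the covering below the `k`-th lift of the fiber. -/
def lower (k : ℤ) : Set (Cover f) := lift f ⁻¹' Set.Iic (height t k)

lemma upper_antitone : Antitone (upper f t) := fun _ _ h _ hy => (height_mono t h).trans hy

lemma lower_monotone : Monotone (lower f t) := fun _ _ h _ hy => le_trans hy (height_mono t h)

lemma exists_subset_lower (m : ℤ) {K : Set (Cover f)} (hK : IsCompact K) :
    ∃ j : ℕ, K ⊆ lower f t (m + j) := by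
  obtain ⟨b, hb⟩ := (hK.image continuous_lift).bddAbove
  obtain ⟨j, hj⟩ := exists_nat_ge (b - height t m)
  refine ⟨j, fun y hy => ?_⟩
  have h1 : lift f y ≤ b := hb ⟨y, hy, rfl⟩
  have h2 := add_le_height t m j
  change lift f y ≤ _
  linarith

lemma exists_subset_upper (m : ℤ) {K : Set (Cover f)} (hK : IsCompact K) :
    ∃ j : ℕ, K ⊆ upper f t (m - j) := by
  obtain ⟨b, hb⟩ := (hK.image continuous_lift).bddBelow
  obtain ⟨j, hj⟩ := exists_nat_ge (height t m - b)
  refine ⟨j, fun y hy => ?_⟩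
  have h1 : b ≤ lift f y := hb ⟨y, hy, rfl⟩
  have h2 := height_le_sub t m j
  change _ ≤ lift f y
  linarith

end Heights

variable {R : Type v} [CommRing R] {M : Type u} [AddCommGroup M] [Module R M] {n : ℕ}

/-- If a class of `F` vanishes in the subspace `P`, then it vanishes in the intersection of `P` with
a member of an exhaustion. -/
lemma exists_corestr_eq_zero {Y F : Type u} [TopologicalSpace Y] [TopologicalSpace F] {P : Set Y}
    {A : ℕ → Set Y} (hA : Monotone A) (hK : ∀ K : Set Y, IsCompact K → ∃ j, K ⊆ A j) (g : C(F, Y))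
    (hP : ∀ x, g x ∈ P) (h0 : ∀ x, g x ∈ A 0) (w : H R M n F)
    (hw : Hmap R M n (corestr g hP) w = 0) :
    ∃ j, ∀ S : Set Y, S = P ∩ A j → ∀ hS : ∀ x, g x ∈ S, Hmap R M n (corestr g hS) w = 0 := by
  let A' : ℕ → Set P := fun j => {y | (y : Y) ∈ A j}
  have hA' : Monotone A' := fun i j hij y hy => hA hij hy
  have hK' : ∀ K : Set P, IsCompact K → ∃ j, K ⊆ A' j := fun K hKc => by
    obtain ⟨j, hj⟩ := hK _ (hKc.image continuous_subtype_val)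
    exact ⟨j, fun y hy => hj ⟨y, hy, rfl⟩⟩
  obtain ⟨j, hj, hz⟩ := exists_Hmap_inclSub_eq_zero hA' hK' 0
    (Hmap R M n (corestr (corestr g hP) (A := A' 0) h0) w) (by
      rw [← Hmap_comp_apply]
      exact hw)
  refine ⟨j, fun S hS hgS => ?_⟩
  subst hS
  let r : C(A' j, (P ∩ A j : Set Y)) := ⟨fun y => ⟨y.1.1, y.1.2, y.2⟩, by fun_prop⟩
  have h := congrArg (Hmap R M n r) hz
  rw [map_zero, ← Hmap_comp_apply, ← Hmap_comp_apply] at h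
  exact h

variable {X : Type u} [TopologicalSpace X] {f : C(X, Circle)} {θ : Circle} {t : ℝ}

/-- The relation on the homology of the fiber can be read off from every slab between two successive
lifts of the fiber: the powers of the deck transformation identify it with `f̃⁻¹([t, t + 2π])`. -/
lemma mem_monodromyRel_iff (ht : Circle.exp t = θ) (k l : ℤ) (S : Set (Cover f)) (hl : l = k + 1)
    (hS : S = upper f t k ∩ lower f t l)
    (hk : ∀ x, fiberAt (exp_height ht k) x ∈ S) (hl' : ∀ x, fiberAt (exp_height ht l) x ∈ S)
    (a b : H R M n (Fiber f θ)) :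
    (a, b) ∈ monodromyRel (f := f) R M n ht ↔
      Hmap R M n (corestr (fiberAt (exp_height ht k)) hk) a =
        Hmap R M n (corestr (fiberAt (exp_height ht l)) hl') b := by
  subst hl hS
  have hper : ∀ (y : Cover f) (m : ℤ), f y.1.1 = Circle.exp (y.1.2 + 2 * Real.pi * m) :=
    fun y m => by rw [Circle.exp_add, Circle.exp_two_pi_mul_int, mul_one]; exact y.2
  let φ : C(Slab f t (t + 2 * Real.pi), (upper f t k ∩ lower f t (k + 1) : Set (Cover f))) :=
    ⟨fun p => ⟨⟨(p.1.1.1, p.1.1.2 + 2 * Real.pi * k), hper p.1 k⟩, by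
      have h1 : t ≤ p.1.1.2 := p.2.1
      have h2 : p.1.1.2 ≤ t + 2 * Real.pi := p.2.2
      refine ⟨?_, ?_⟩
      · change height t k ≤ p.1.1.2 + 2 * Real.pi * k
        simp only [height]
        linarith
      · change p.1.1.2 + 2 * Real.pi * k ≤ height t (k + 1)
        rw [height_succ]
        simp only [height]
        linarith⟩, by fun_prop⟩
  let χ : C((upper f t k ∩ lower f t (k + 1) : Set (Cover f)), Slab f t (t + 2 * Real.pi)) :=
    ⟨fun p => ⟨⟨(p.1.1.1, p.1.1.2 + 2 * Real.pi * (-k : ℤ)), hper p.1 (-k)⟩, by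
      have h1 : height t k ≤ p.1.1.2 := p.2.1
      have h2 : p.1.1.2 ≤ height t (k + 1) := p.2.2
      rw [height_succ] at h2
      simp only [height] at h1 h2
      refine ⟨?_, ?_⟩
      · change t ≤ p.1.1.2 + 2 * Real.pi * (-k : ℤ)
        push_cast
        linarith
      · change p.1.1.2 + 2 * Real.pi * (-k : ℤ) ≤ t + 2 * Real.pi
        push_cast
        linarith⟩, by fun_prop⟩
  have h₁ : χ.comp φ = .id _ := ContinuousMap.ext fun p => by
    refine Subtype.ext (Subtype.ext (Prod.ext rfl ?_))
    change p.1.1.2 + 2 * Real.pi * k + 2 * Real.pi * (-k : ℤ) = p.1.1.2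
    push_cast
    ring
  have h₂ : φ.comp χ = .id _ := ContinuousMap.ext fun p => by
    refine Subtype.ext (Subtype.ext (Prod.ext rfl ?_))
    change p.1.1.2 + 2 * Real.pi * (-k : ℤ) + 2 * Real.pi * k = p.1.1.2
    push_cast
    ring
  have e₁ : corestr (fiberAt (exp_height ht k)) hk = φ.comp (inclLower ht) := rfl
  have e₂ : corestr (fiberAt (exp_height ht (k + 1))) hl' = φ.comp (inclUpper ht) :=
    ContinuousMap.ext fun x => by
      refine Subtype.ext (Subtype.ext (Prod.ext rfl ?_))
      change height t (k + 1) = t + 2 * Real.pi + 2 * Real.pi * k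
      rw [height_succ]
      simp only [height]
      ring
  rw [e₁, e₂, Hmap_comp_apply, Hmap_comp_apply,
    (Hmap_bijective_of_inverse h₁ h₂).1.eq_iff]
  rfl

/-- The slabs of the infinite cyclic covering of a map, cut along the lifts of the fiber over a tame
value. -/
def slabSystem (hθ : IsTameValue f θ) (ht : Circle.exp t = θ) (R : Type v) [CommRing R]
    (M : Type u) [AddCommGroup M] [Module R M] (n : ℕ) :
    SlabSystem R M n (Cover f) (Fiber f θ) where
  up := upper f t
  dn := lower f t
  lvl k := fiberAt (exp_height ht k)
  rel := monodromyRel R M n ht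
  up_anti := upper_antitone f t
  dn_mono := lower_monotone f t
  cover k := Set.eq_univ_of_forall fun y => le_total (lift f y) (height t k)
  lvl_up k x := le_refl (height t k)
  lvl_dn k x := le_refl (height t k)
  exists_of_eq k A B C hAC hBC hC hA hB hFA hFB hk a b hab :=
    exists_of_fiber hθ (exp_height ht k) hAC hBC hC hA hB hFA hFB (fun y hy => hk (by
      have h1 := height_succ t k
      have h2 := height_succ t (k - 1)
      rw [sub_add_cancel] at h2
      obtain ⟨h3, h4⟩ := abs_lt.1 hy
      have := Real.pi_pos
      refine ⟨?_, ?_⟩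
      · change height t (k - 1) ≤ lift f y
        linarith
      · change lift f y ≤ height t (k + 1)
        linarith)) a b hab
  mem_rel_iff := mem_monodromyRel_iff ht
  compact_up k w hw := by
    obtain ⟨j, hj⟩ := exists_corestr_eq_zero (A := fun j => lower f t (k + 1 + j))
      (fun i j hij => lower_monotone f t (by omega))
      (fun K hK => exists_subset_lower f t (k + 1) hK) _ _
      (fun x => height_mono t (by simp)) w hw
    exact ⟨k + 1 + j, by omega, hj⟩
  compact_dn k w hw := by
    obtain ⟨j, hj⟩ := exists_corestr_eq_zero (A := fun j => upper f t (k - 1 - j))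
      (fun i j hij => upper_antitone f t (by omega))
      (fun K hK => exists_subset_upper f t (k - 1) hK) _ _
      (fun x => height_mono t (by simp)) w hw
    exact ⟨k - 1 - j, by omega, fun S hS => hj S (hS.trans (Set.inter_comm _ _))⟩
  exhaust_dn x := by
    obtain ⟨K, z, hz⟩ := exists_Hmap_incl_eq (A := fun j : ℕ => lower f t (0 + j))
      (fun i j hij => lower_monotone f t (by omega))
      (fun K hK => exists_subset_lower f t 0 hK) x
    refine ⟨K, fun k hk => ⟨Hmap R M n (inclSub (lower_monotone f t (by omega))) z, ?_⟩⟩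
    rw [← Hmap_comp_apply]
    exact hz
  exhaust_up x := by
    obtain ⟨K, z, hz⟩ := exists_Hmap_incl_eq (A := fun j : ℕ => upper f t (0 - j))
      (fun i j hij => upper_antitone f t (by omega))
      (fun K hK => exists_subset_upper f t 0 hK) x
    refine ⟨K, fun k hk => ⟨Hmap R M n (inclSub (upper_antitone f t (by omega))) z, ?_⟩⟩
    rw [← Hmap_comp_apply]
    exact hz

section Kernels

variable (hθ : IsTameValue f θ) (ht : Circle.exp t = θ) (x : H R M n (Cover f))

lemma mem_ker_toNovPlus_iff :
    x ∈ LinearMap.ker (toNovPlus R M (lift f) n) ↔ (slabSystem hθ ht R M n).IsUpLimit x := by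
  let a : ℕ → ℝᵒᵖ := fun k => .op (height t k)
  let s : ∀ k, a (k + 1) ⟶ a k := fun k =>
    (homOfLE (height_mono t (by omega : (k : ℤ) ≤ (k + 1 : ℕ)))).op
  constructor
  · intro hx
    exact exists_seq_of_toLimit_eq_zero (A := superlevel (lift f)) a s x hx
  · rintro ⟨y, hy, hyx⟩
    refine toLimit_eq_zero_of_seq (A := superlevel (lift f)) a s (fun r => ?_) x y hy (hyx 0)
    obtain ⟨j, hj⟩ := exists_nat_ge (r.unop - height t 0)
    have h := add_le_height t 0 j
    rw [zero_add] at h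
    exact ⟨j, ⟨(homOfLE (by linarith : r.unop ≤ height t j)).op⟩⟩

lemma mem_ker_toNovMinus_iff :
    x ∈ LinearMap.ker (toNovMinus R M (lift f) n) ↔ (slabSystem hθ ht R M n).dual.IsUpLimit x := by
  let a : ℕ → ℝ := fun k => height t (-(k : ℤ))
  let s : ∀ k, a (k + 1) ⟶ a k := fun k =>
    homOfLE (height_mono t (by omega : -((k + 1 : ℕ) : ℤ) ≤ -(k : ℤ)))
  constructor
  · intro hx
    exact exists_seq_of_toLimit_eq_zero (A := sublevel (lift f)) a s x hx
  · rintro ⟨y, hy, hyx⟩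
    refine toLimit_eq_zero_of_seq (A := sublevel (lift f)) a s (fun r => ?_) x y hy (hyx 0)
    obtain ⟨j, hj⟩ := exists_nat_ge (height t 0 - r)
    have h := height_le_sub t 0 j
    rw [zero_sub] at h
    exact ⟨j, ⟨homOfLE (by linarith : height t (-(j : ℤ)) ≤ r)⟩⟩

lemma slabSystem_ι_zero :
    (slabSystem hθ ht R M n).ι 0 = Hmap R M n (inclCover (f := f) ht) := by
  have e : (slabSystem hθ ht R M n).lvl 0 = inclCover ht := ContinuousMap.ext fun x => by
    refine Subtype.ext (Prod.ext rfl ?_)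
    change height t 0 = t
    simp [height]
  exact congrArg (Hmap R M n) e

include hθ in
lemma mem_commonKer_iff :
    x ∈ commonKer f R M n ↔
      ∃ v ∈ Dtot (monodromyRel (f := f) R M n ht), Hmap R M n (inclCover ht) v = x := by
  rw [← slabSystem_ι_zero hθ ht]
  refine Iff.trans ?_ ((slabSystem hθ ht R M n).isUpLimit_and_iff x)
  rw [← mem_ker_toNovMinus_iff, ← mem_ker_toNovPlus_iff]
  exact Prod.mk_eq_zero

include hθ in
lemma Hmap_inclCover_eq_zero_iff (v : H R M n (Fiber f θ)) :
    Hmap R M n (inclCover (f := f) ht) v = 0 ↔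
      v ∈ Kminus (monodromyRel (f := f) R M n ht) ⊔ Kplus (monodromyRel (f := f) R M n ht) := by
  rw [← slabSystem_ι_zero hθ ht]
  exact (slabSystem hθ ht R M n).ι_eq_zero_iff v

lemma Hmap_inclCover_eq_of_rel {v w : H R M n (Fiber f θ)}
    (h : (v, w) ∈ monodromyRel (f := f) R M n ht) :
    Hmap R M n (inclCover ht) v = Hmap R M n (deck f) (Hmap R M n (inclCover ht) w) := by
  have h' := congrArg (Hmap R M n (⟨Subtype.val, continuous_subtype_val⟩ :
    C(Slab f t (t + 2 * Real.pi), Cover f))) (LinearMap.mem_eqLocus.1 h)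
  simp only [LinearMap.comp_apply, LinearMap.fst_apply, LinearMap.snd_apply] at h'
  rw [← Hmap_comp_apply, ← Hmap_comp_apply] at h'
  rw [← Hmap_comp_apply]
  exact h'

lemma Hmap_deck_injective : Function.Injective (Hmap R M n (deck f)) := by
  let g : C(Cover f, Cover f) := ⟨fun p => ⟨(p.1.1, p.1.2 - 2 * Real.pi), by
    rw [Circle.exp_sub_two_pi]
    exact p.2⟩, by fun_prop⟩
  refine (Hmap_bijective_of_inverse (k := g) ?_ ?_).1 <;>
    exact ContinuousMap.ext fun p => Subtype.ext (Prod.ext rfl (by simp [g, deck]))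

end Kernels

end AngleValued

namespace AngleValued

open NovikovHomology LinRel

/-! ### The regular part and the kernel of the maps to Novikov homology -/

section Regular

variable {X : Type u} [TopologicalSpace X] {f : C(X, Circle)} {θ : Circle} {t : ℝ}
  (hθ : IsTameValue f θ) (ht : Circle.exp t = θ) (R : Type v) [CommRing R] (M : Type u)
  [AddCommGroup M] [Module R M] (n : ℕ)

/-- The inclusion of the fiber, as a map from `D` to the common kernel of the maps to Novikov
homology. -/
def dtotToKer : Dtot (monodromyRel (f := f) R M n ht) →ₗ[R] commonKer f R M n :=
  (Hmap R M n (inclCover (f := f) ht) ∘ₗ (Dtot _).subtype).codRestrict _ fun d =>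
    (mem_commonKer_iff hθ ht _).2 ⟨d, d.2, rfl⟩

lemma dtotToKer_surjective : Function.Surjective (dtotToKer hθ ht R M n) := fun x => by
  obtain ⟨v, hv, hx⟩ := (mem_commonKer_iff hθ ht _).1 x.2
  exact ⟨⟨v, hv⟩, Subtype.ext hx⟩

lemma ker_dtotToKer : LinearMap.ker (dtotToKer hθ ht R M n) =
    (Kminus (monodromyRel (f := f) R M n ht) ⊔ Kplus (monodromyRel (f := f) R M n ht)).submoduleOf
      (Dtot (monodromyRel (f := f) R M n ht)) := by
  ext d
  exact Subtype.ext_iff.trans (Hmap_inclCover_eq_zero_iff hθ ht (d : H R M n (Fiber f θ)))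

/-- The regular part of the homology of the fiber is the common kernel of the maps to Novikov
homology. -/
def regEquiv : Reg (monodromyRel (f := f) R M n ht) ≃ₗ[R] commonKer f R M n :=
  (Submodule.quotEquivOfEq _ _ (ker_dtotToKer hθ ht R M n).symm).trans
    ((dtotToKer hθ ht R M n).quotKerEquivOfSurjective (dtotToKer_surjective hθ ht R M n))

lemma regEquiv_proj (d : Dtot (monodromyRel (f := f) R M n ht)) :
    (regEquiv hθ ht R M n (Reg.proj _ d) : H R M n (Cover f)) =
      Hmap R M n (inclCover (f := f) ht) d :=
  rfl

include hθ ht in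
lemma Hmap_deck_mem_commonKer (x : H R M n (Cover f)) (hx : x ∈ commonKer f R M n) :
    Hmap R M n (deck f) x ∈ commonKer f R M n := by
  obtain ⟨d, hd, rfl⟩ := (mem_commonKer_iff hθ ht _).1 hx
  obtain ⟨d', hd', h⟩ := exists_rel_to_mem_Dtot hd
  exact (mem_commonKer_iff hθ ht _).2 ⟨d', hd', Hmap_inclCover_eq_of_rel ht h⟩

/-- The automorphism of the common kernel induced by the fundamental deck transformation. -/
def deckEquiv : commonKer f R M n ≃ₗ[R] commonKer f R M n :=
  LinearEquiv.ofBijective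
    ((Hmap R M n (deck f)).restrict (Hmap_deck_mem_commonKer hθ ht R M n)) (by
      refine ⟨fun x y h => Subtype.ext (Hmap_deck_injective (congrArg Subtype.val h)), fun x => ?_⟩
      obtain ⟨d, hd, hx⟩ := (mem_commonKer_iff hθ ht _).1 x.2
      obtain ⟨d', hd', h⟩ := exists_rel_of_mem_Dtot hd
      exact ⟨⟨_, (mem_commonKer_iff hθ ht _).2 ⟨d', hd', rfl⟩⟩,
        Subtype.ext ((Hmap_inclCover_eq_of_rel ht h).symm.trans hx)⟩)

lemma coe_deckEquiv (x : commonKer f R M n) :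
    (deckEquiv hθ ht R M n x : H R M n (Cover f)) = Hmap R M n (deck f) x :=
  rfl

lemma mem_regRel_iff (v w : Reg (monodromyRel (f := f) R M n ht)) :
    (v, w) ∈ regRel (monodromyRel (f := f) R M n ht) ↔
      regEquiv hθ ht R M n w = (deckEquiv hθ ht R M n).symm (regEquiv hθ ht R M n v) := by
  rw [LinearEquiv.eq_symm_apply]
  constructor
  · rintro ⟨⟨d, e⟩, h, hde⟩
    obtain ⟨rfl, rfl⟩ := Prod.ext_iff.1 hde
    exact Subtype.ext (Hmap_inclCover_eq_of_rel ht h).symm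
  · intro h
    obtain ⟨d, rfl⟩ := Submodule.mkQ_surjective _ v
    obtain ⟨e, rfl⟩ := Submodule.mkQ_surjective _ w
    -- The successor `d₁` of `d` in `D` has the same class as `e`.
    obtain ⟨d₁, hd₁, hrel⟩ := exists_rel_of_mem_Dtot d.2
    have key : Reg.proj (monodromyRel (f := f) R M n ht) ⟨d₁, hd₁⟩ = Reg.proj _ e := by
      refine (regEquiv hθ ht R M n).injective (Subtype.ext (Hmap_deck_injective ?_))
      exact (Hmap_inclCover_eq_of_rel ht hrel).symm.trans (congrArg Subtype.val h).symm
    exact ⟨(d, ⟨d₁, hd₁⟩), hrel, Prod.ext rfl key⟩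

variable {R M n}

include hθ ht in
lemma commonKer_eq_ker_toNovPlus [IsArtinian R (H R M n (Fiber f θ))] :
    commonKer f R M n = LinearMap.ker (toNovPlus R M (lift f) n) := by
  refine le_antisymm (fun x hx => (Prod.mk_eq_zero.1 hx).2) fun x hx => ?_
  obtain ⟨v, hv, h⟩ := (slabSystem hθ ht R M n).exists_mem_Dtot_of_isUpLimit
    ((mem_ker_toNovPlus_iff hθ ht x).1 hx)
  rw [slabSystem_ι_zero] at h
  exact (mem_commonKer_iff hθ ht x).2 ⟨v, hv, h⟩

include hθ ht in
lemma commonKer_eq_ker_toNovMinus [IsArtinian R (H R M n (Fiber f θ))] :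
    commonKer f R M n = LinearMap.ker (toNovMinus R M (lift f) n) := by
  refine le_antisymm (fun x hx => (Prod.mk_eq_zero.1 hx).1) fun x hx => ?_
  obtain ⟨v, hv, h⟩ := (slabSystem hθ ht R M n).dual.exists_mem_Dtot_of_isUpLimit
    ((mem_ker_toNovMinus_iff hθ ht x).1 hx)
  have h' : (slabSystem hθ ht R M n).ι 0 v = x := h
  rw [slabSystem_ι_zero] at h'
  exact (mem_commonKer_iff hθ ht x).2 ⟨v, ⟨hv.2, hv.1⟩, h'⟩

include hθ ht in
lemma finite_commonKer [IsNoetherian R (H R M n (Fiber f θ))] :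
    Module.Finite R (commonKer f R M n) :=
  Module.Finite.of_surjective _ (dtotToKer_surjective hθ ht R M n)

end Regular

end AngleValued

end

theorem theoremT {X : Type u} [TopologicalSpace X] (f : C(X, Circle)) (θ : Circle)
    (hθ : AngleValued.IsTameValue f θ) (t : ℝ) (ht : Circle.exp t = θ)
    (R : Type v) [CommRing R] (M : Type u) [AddCommGroup M] [Module R M] (n : ℕ) :
    (∃ (φ : LinRel.Reg (AngleValued.monodromyRel (f := f) R M n ht) ≃ₗ[R]
          AngleValued.commonKer f R M n)
        (T : AngleValued.commonKer f R M n ≃ₗ[R] AngleValued.commonKer f R M n),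
      (∀ d : LinRel.Dtot (AngleValued.monodromyRel (f := f) R M n ht),
        (φ (LinRel.Reg.proj _ d) : NovikovHomology.H R M n (AngleValued.Cover f)) =
          NovikovHomology.Hmap R M n (AngleValued.inclCover ht) d) ∧
      (∀ x, (T x : NovikovHomology.H R M n (AngleValued.Cover f)) =
          NovikovHomology.Hmap R M n (AngleValued.deck f) x) ∧
      ∀ v w, (v, w) ∈ LinRel.regRel (AngleValued.monodromyRel (f := f) R M n ht) ↔
        φ w = T.symm (φ v)) ∧
    (IsField R →
      Module.Finite R (NovikovHomology.H R M n (AngleValued.Fiber f θ)) →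
        AngleValued.commonKer f R M n =
          LinearMap.ker (NovikovHomology.toNovMinus R M (AngleValued.lift f) n) ∧
        AngleValued.commonKer f R M n =
          LinearMap.ker (NovikovHomology.toNovPlus R M (AngleValued.lift f) n) ∧
        Module.Finite R (AngleValued.commonKer f R M n)) := by
  refine ⟨⟨AngleValued.regEquiv hθ ht R M n, AngleValued.deckEquiv hθ ht R M n,
    AngleValued.regEquiv_proj hθ ht R M n, AngleValued.coe_deckEquiv hθ ht R M n,
    AngleValued.mem_regRel_iff hθ ht R M n⟩, fun hR hfin => ?_⟩
  have : IsArtinianRing R := @DivisionRing.instIsArtinianRing R hR.toField.toDivisionRing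
  have : IsNoetherianRing R := inferInstance
  exact ⟨AngleValued.commonKer_eq_ker_toNovMinus hθ ht,
    AngleValued.commonKer_eq_ker_toNovPlus hθ ht, AngleValued.finite_commonKer hθ ht⟩
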